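/- **Setting.** Let $y_t=x_t+\sigma\zeta_t$, $t\in\mathbb Z$, where $x:\mathbb Z\to\mathbb C$ is deterministic, $\sigma>0$, and the $\zeta_t$ are i.i.d. standard complex Gaussian (real and imaginary parts are independent $\mathcal N(0,1)$). Let $[u*v]_t=\sum_{\tau}u_\tau v_{t-\tau}$, $[\Delta^k u]_t=u_{t-k}$ for $k\in\mathbb Z$, and $\|u\|_{n,2}=(\sum_{t=0}^n|u_t|^2)^{1/2}$. Let $\|u\|^*_{n,1}=\sum_{k=0}^n|[F_nu]_k|$, where $[F_nu]_k=(n+1)^{-1/2}\sum_{t=0}^n u_te^{2\pi i kt/(n+1)}$. Let $\mathbb C(\mathbb Z_{a,b})$ be the set of sequences vanishing outside $[a,b]$. *Predictability.* $x$ is $(m,n,h,\varrho)$-predictable if there is $\varphi\in\mathbb C(\mathbb Z_{h,m+h})$ with $\mathbf E|x_t-[\varphi*y]_t|^2\le\varrho\sigma^2/(m+1)$ for all $-m+h\le t\le n+h$. *Assumption 1 on $[-n,n+h]$, with parameters $s,\varkappa$.* $1\le s\le n+1$, $\varkappa\ge0$, and $x=x^{\mathcal S}+\varepsilon$, where $x^{\mathcal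 S}\in\mathcal S$ for some linear subspace $\mathcal S$ of $\mathbb C^{\mathbb Z}$ of dimension $s$ with $\Delta\mathcal S\subseteq\mathcal S$, and $\|\Delta^\tau\varepsilon\|_{n,2}\le\varkappa\sigma$ for all integers $-h\le\tau\le n$ (i.e. on all windows of $n+1$ consecutive points of $[-n,n+h]$). *$h$-predicting constrained least-squares estimator with parameter $\overline\varrho$.* $\widehat\varphi*y$, where $\widehat\varphi$ is any minimizer of $\|\Delta^{-h}[y-\varphi*y]\|_{n,2}^2$ over $\varphi\in\mathbb C(\mathbb Z_{h,n+h})$ subject to $\|\Delta^{-h}\varphi\|^*_{n,1}\le\overline\varrho/\sqrt{n+1}$. **Proposition.** There is an absolute constant $C>0$ such that the following holds. Let $m\ge1$, $n=2m$, $h_0\ge0$ be integers and let $\varrho\ge1$. Suppose that $x$ is $(m,n+2h_0,h_0,\varrho)$-predictable and that Assumption 1 holds on $[-n,n+2h_0]$ with parameters $s,\varkappa$. Then for every $\alpha\in(0,1)$ there is a (measurable) set $\Xi_\alpha$ of noise realizations with $\mathbb P\{\zeta\in\Xi_\alpha\}\ge1-\alpha$ such that, whenever $\zeta\in\Xi_\alpha$,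 every $2h_0$-predicting constrained least-squares filter $\widehat\varphi$ with $\overline\varrho=2\varrho$ satisfies $$\big\|\Delta^{-2h_0}[x-\widehat\varphi*y]\big\|_{n,2}^2\le C\sigma^2\big[\varrho^2(1+\ln(1/\alpha))+E_0\big],$$ $$\big|[x-\widehat\varphi*y]_t\big|^2\le C\,\frac{\sigma^2\varrho}{n+1}\big[\varrho^2(1+\ln(1/\alpha))+E_0\big]\quad\text{for all integers } t\in[m+3h_0,\,n+3h_0],$$ where $$E_0=\varrho\,\frac{n+1}{m+1}\,\ln\frac{m+n}{\alpha}+\varrho\,\varkappa\sqrt{1+\ln(1/\alpha)}+s .$$ (The filter $\widehat\varphi$ and the values $[\widehat\varphi*y]_t$ above involve only the observations on $[-n,n+2h_0]$, so the pointwise bound extends the recovery up to $t=n+3h_0$, beyond the observation domain when $h_0\ge1$.) -/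

import Mathlib

open MeasureTheory ProbabilityTheory

noncomputable section

/-- The space of two-sided sequences vanishing outside the integer interval `[a, b]`. -/
def seqSupportedOn (a b : ℤ) : Set (ℤ → ℂ) :=
  {u | ∀ t : ℤ, t ∉ Set.Icc a b → u t = 0}

/-- The power `k` (possibly negative) of the right shift: `(shiftSeq k u) t = u (t - k)`. -/
def shiftSeq (k : ℤ) (u : ℤ → ℂ) : ℤ → ℂ :=
  fun t => u (t - k)

/-- Convolution of two-sided sequences. It is only applied to finitely supported `u`,
for which the series is a finite sum. -/
def convSeq (u v : ℤ → ℂ) : ℤ → ℂ :=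
  fun t => ∑' τ : ℤ, u τ * v (t - τ)

/-- The Euclidean norm of the vector `(u 0, …, u n)`. -/
def windowNorm (n : ℕ) (u : ℤ → ℂ) : ℝ :=
  √(∑ t ∈ Finset.range (n + 1), ‖u (t : ℤ)‖ ^ 2)

/-- The coefficient number `k` of the unitary discrete Fourier transform of `(u 0, …, u n)`. -/
def dftCoeff (n : ℕ) (u : ℤ → ℂ) (k : ℕ) : ℂ :=
  ((√((n : ℝ) + 1))⁻¹ : ℝ) *
    ∑ t ∈ Finset.range (n + 1),
      u (t : ℤ) * Complex.exp (2 * Real.pi * Complex.I * k * t / (n + 1))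

/-- The `ℓ₁` norm of the unitary discrete Fourier transform of `(u 0, …, u n)`. -/
def dftNormOne (n : ℕ) (u : ℤ → ℂ) : ℝ :=
  ∑ k ∈ Finset.range (n + 1), ‖dftCoeff n u k‖

/-- The observed sequence `y = x + σ z` when the noise takes the value `z`. -/
def observedSeq (x : ℤ → ℂ) (σ : ℝ) (z : ℤ → ℂ) : ℤ → ℂ :=
  fun t => x t + σ * z t

/-- `ζ` is a family of i.i.d. standard complex Gaussian random variables, normalised so that
the real and the imaginary part of each `ζ t` are independent standard real Gaussians. -/
structure IsStdComplexGaussianNoise {Ω : Type*} [MeasurableSpace Ω] (μ : Measure Ω)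
    (ζ : ℤ → Ω → ℂ) : Prop where
  measurable : ∀ t, Measurable (ζ t)
  law_re : ∀ t, μ.map (fun ω => (ζ t ω).re) = gaussianReal 0 1
  law_im : ∀ t, μ.map (fun ω => (ζ t ω).im) = gaussianReal 0 1
  indep : iIndepFun
    (fun (p : ℤ × Bool) (ω : Ω) => if p.2 then (ζ p.1 ω).re else (ζ p.1 ω).im) μ

/-- `x` is `(m, n, h, ρ)`-predictable from its noisy observations `x + σ ζ`: some filter supported
on `[h, m + h]` reproduces `x` on `[-m + h, n + h]` with mean square error
at most `ρ σ² / (m + 1)`. -/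
def IsPredictableSignal {Ω : Type*} [MeasurableSpace Ω] (μ : Measure Ω) (ζ : ℤ → Ω → ℂ) (σ : ℝ)
    (m n h : ℕ) (ρ : ℝ) (x : ℤ → ℂ) : Prop :=
  ∃ φ ∈ seqSupportedOn (h : ℤ) ((m : ℤ) + h),
    ∀ t : ℤ, -(m : ℤ) + h ≤ t → t ≤ (n : ℤ) + h →
      ∫ ω, ‖x t - convSeq φ (observedSeq x σ (fun τ => ζ τ ω)) t‖ ^ 2 ∂μ
        ≤ ρ * σ ^ 2 / ((m : ℝ) + 1)

/-- Approximate shift-invariance of `x` on the interval `[a, b]`: `x = xS + ε`, where `xS` belongs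
to a shift-invariant subspace of dimension `s`, with `1 ≤ s ≤ n + 1`, and where `ε` has Euclidean
norm at most `ϰ σ` on every window `[-τ, n - τ]` of `n + 1` consecutive points of `[a, b]`. -/
def IsNearShiftInvariantOn (a b : ℤ) (n s : ℕ) (ϰ σ : ℝ) (x : ℤ → ℂ) : Prop :=
  1 ≤ s ∧ s ≤ n + 1 ∧
    ∃ S : Submodule ℂ (ℤ → ℂ),
      FiniteDimensional ℂ S ∧ Module.finrank ℂ S = s ∧
      (∀ u ∈ S, shiftSeq 1 u ∈ S) ∧
      ∃ xS ∈ S, ∃ ε : ℤ → ℂ, x = xS + ε ∧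
        ∀ τ : ℤ, a ≤ -τ → (n : ℤ) - τ ≤ b → windowNorm n (shiftSeq τ ε) ≤ ϰ * σ

/-- The feasible filters of the `h`-predicting constrained least-squares problem. -/
def predictFeasible (n h : ℕ) (r : ℝ) : Set (ℤ → ℂ) :=
  {φ | φ ∈ seqSupportedOn (h : ℤ) ((n : ℤ) + h) ∧
    dftNormOne n (shiftSeq (-(h : ℤ)) φ) ≤ r / √((n : ℝ) + 1)}

/-- `φ` is an optimal solution of the `h`-predicting constrained least-squares problem
with data `y` and constraint level `r`. -/
def IsPredictLSE (n h : ℕ) (r : ℝ) (y φ : ℤ → ℂ) : Prop :=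
  φ ∈ predictFeasible n h r ∧
    IsMinOn (fun ψ => windowNorm n (shiftSeq (-(h : ℤ)) (y - convSeq ψ y)) ^ 2)
      (predictFeasible n h r) φ

/-- The remainder term
`ρ κ² ln((m + n) / α) + ρ ϰ √(1 + ln(1 / α)) + s`, with `κ² = (n + 1) / (m + 1)`. -/
def oracleRemainder (m n : ℕ) (ρ ϰ : ℝ) (s : ℕ) (α : ℝ) : ℝ :=
  ρ * (((n : ℝ) + 1) / ((m : ℝ) + 1)) * Real.log (((m : ℝ) + n) / α)
    + ρ * ϰ * √(1 + Real.log (1 / α)) + s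

end

/-!
Squaring the predicting filter `q` gives an oracle `q * q` with delay `2 h₀`. It is feasible,
because the `ℓ₁` norm of the discrete Fourier transform of `q * q` is `√(n + 1)` times the energy of
`q`, and predictability bounds both its bias and that energy. The optimality of the least-squares
estimator `φ` then bounds the error by the oracle error, up to the inner product of the noise with
`(q * q - φ) * y`. The noise is split along the windows of the shift-invariant subspace. The
component in this subspace is small since its dimension is `s`. The other component does not see the
shift-invariant part of the signal; its inner product with the rest of `(q * q - φ) * y` is bounded,
by duality with the `ℓ₁` constraint, by the largest inner product over the `n + 1` harmonic filters,
and each of these is a quadratic form in Gaussian variables. The pointwise bound rests on the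
identity `e = q * e + g - φ * g - σ φ * z + σ φ * q * z` for the errors `e = x - φ * y` and
`g = x - q * x`, in which convolution with `q` turns the mean square bound on `e` into a pointwise
one.
-/

/-! ### Exponential moments of Gaussian quadratic forms -/

theorem exp_neg_add_sq_le_one_sub {u : ℝ} (hu : |u| ≤ 1 / 2) :
    Real.exp (-(u + u ^ 2)) ≤ 1 - u := by
  have hu_upper := (abs_le.1 hu).2
  rw [Real.exp_neg, inv_le_comm₀ (Real.exp_pos _) (by linarith),
    inv_le_iff_one_le_mul₀ (by linarith)]
  rcases le_total 0 u with h | h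
  · have hexp := Real.quadratic_le_exp_of_nonneg (x := u + u ^ 2) (by positivity)
    refine le_trans ?_ (mul_le_mul_of_nonneg_right hexp (by linarith))
    nlinarith [mul_nonneg (pow_nonneg h 3) (by linarith : (0 : ℝ) ≤ 1 / 2 - u), pow_nonneg h 2,
      mul_nonneg (pow_nonneg h 2) (by linarith : (0 : ℝ) ≤ 1 / 2 - u)]
  · have hexp := Real.add_one_le_exp (u + u ^ 2)
    refine le_trans ?_ (mul_le_mul_of_nonneg_right hexp (by linarith))
    nlinarith [mul_nonneg (neg_nonneg.2 h) (sq_nonneg u)]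

theorem integral_exp_mul_sq_gaussianReal {c : ℝ} (hc : c < 1 / 2) :
    ∫ x, Real.exp (c * x ^ 2) ∂(gaussianReal 0 1) = √(1 / (1 - 2 * c)) := by
  have hdensity (x : ℝ) : gaussianPDFReal 0 1 x • Real.exp (c * x ^ 2)
      = (√(2 * Real.pi))⁻¹ * Real.exp (-(1 / 2 - c) * x ^ 2) := by
    simp only [gaussianPDFReal, smul_eq_mul, mul_assoc, ← Real.exp_add, NNReal.coe_one, mul_one,
      sub_zero]
    congr 2
    ring
  rw [integral_gaussianReal_eq_integral_smul one_ne_zero]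
  simp_rw [hdensity]
  rw [integral_const_mul, integral_gaussian, ← Real.sqrt_inv, ← Real.sqrt_mul (by positivity)]
  have hc₂ : 1 - 2 * c ≠ 0 := by linarith
  congr 1
  field_simp

theorem integrable_exp_mul_sq_gaussianReal {c : ℝ} (hc : c < 1 / 2) :
    Integrable (fun x => Real.exp (c * x ^ 2)) (gaussianReal 0 1) := by
  refine Integrable.of_integral_ne_zero ?_
  rw [integral_exp_mul_sq_gaussianReal hc]
  exact (Real.sqrt_pos.2 (one_div_pos.2 (by linarith))).ne'

theorem integral_exp_mul_sq_gaussianReal_le {c : ℝ} (hc : |c| ≤ 1 / 4) :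
    ∫ x, Real.exp (c * x ^ 2) ∂(gaussianReal 0 1) ≤ Real.exp (c + 2 * c ^ 2) := by
  have hc_upper := (abs_le.1 hc).2
  rw [integral_exp_mul_sq_gaussianReal (by linarith)]
  refine Real.sqrt_le_iff.2 ⟨(Real.exp_pos _).le, ?_⟩
  rw [one_div, inv_le_comm₀ (by linarith) (by positivity), ← Real.exp_nat_mul, ← Real.exp_neg]
  refine le_of_eq_of_le ?_ (exp_neg_add_sq_le_one_sub (u := 2 * c) ?_)
  · congr 1
    push_cast
    ring
  · rw [abs_mul, abs_two]
    linarith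

section HilbertSchmidt

variable {𝕜 E F ι κ : Type*} [RCLike 𝕜] [NormedAddCommGroup E] [InnerProductSpace 𝕜 E]
  [NormedAddCommGroup F] [InnerProductSpace 𝕜 F] [Fintype ι] [Fintype κ]

theorem sum_norm_sq_inner_apply_orthonormalBasis_le (b : OrthonormalBasis ι 𝕜 E) (A : E →L[𝕜] F)
    (v : F) : ∑ i, ‖inner 𝕜 v (A (b i))‖ ^ 2 ≤ (‖A‖ * ‖v‖) ^ 2 := by
  have := b.toBasis.finiteDimensional_of_finite
  have := FiniteDimensional.complete 𝕜 E
  let f : StrongDual 𝕜 E := innerSL 𝕜 v ∘L A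
  let y : E := (InnerProductSpace.toDual 𝕜 E).symm f
  have hy (x : E) : inner 𝕜 v (A x) = inner 𝕜 y x :=
    (InnerProductSpace.toDual_symm_apply (x := x) (y := f)).symm
  simp only [hy, b.sum_sq_norm_inner_left]
  gcongr
  calc ‖y‖ = ‖f‖ := LinearIsometryEquiv.norm_map _ f
    _ ≤ ‖innerSL 𝕜 v‖ * ‖A‖ := ContinuousLinearMap.opNorm_comp_le _ _
    _ = ‖A‖ * ‖v‖ := by rw [innerSL_apply_norm, mul_comm]

theorem sum_norm_sq_starProjection_apply_orthonormalBasis_le (b : OrthonormalBasis ι 𝕜 E)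
    {A : E →L[𝕜] F} (hA : ‖A‖ ≤ 1) (K : Submodule 𝕜 F) [FiniteDimensional 𝕜 K] :
    ∑ i, ‖K.starProjection (A (b i))‖ ^ 2 ≤ Module.finrank 𝕜 K := by
  let c := stdOrthonormalBasis 𝕜 K
  have hcoord (y : F) : ‖K.starProjection y‖ ^ 2 = ∑ k, ‖inner 𝕜 (c k : F) y‖ ^ 2 := by
    rw [Submodule.starProjection_apply, ← Submodule.coe_norm, ← c.sum_sq_norm_inner_right]
    simp only [← Submodule.inner_orthogonalProjectionOnto_eq_of_mem_left]
  simp only [hcoord]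
  rw [Finset.sum_comm]
  calc ∑ k, ∑ i, ‖inner 𝕜 (c k : F) (A (b i))‖ ^ 2
      ≤ ∑ k, (‖A‖ * ‖(c k : F)‖) ^ 2 :=
        Finset.sum_le_sum fun k _ => sum_norm_sq_inner_apply_orthonormalBasis_le b A _
    _ ≤ ∑ _k, 1 := by
        refine Finset.sum_le_sum fun k _ => pow_le_one₀ (by positivity) ?_
        rwa [← Submodule.coe_norm, c.norm_eq_one, mul_one]
    _ = Module.finrank 𝕜 K := by simp

theorem norm_sum_inner_orthogonal_starProjection_le (b : OrthonormalBasis ι 𝕜 E)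
    {A B : E →L[𝕜] F} (hA : ‖A‖ ≤ 1) (K : Submodule 𝕜 F) [FiniteDimensional 𝕜 K] :
    ‖∑ i, inner 𝕜 (Kᗮ.starProjection (A (b i))) (B (b i))‖ ≤
      ‖∑ i, inner 𝕜 (A (b i)) (B (b i))‖
        + √(Module.finrank 𝕜 K) * √(∑ i, ‖B (b i)‖ ^ 2) := by
  have hsplit (i : ι) : inner 𝕜 (Kᗮ.starProjection (A (b i))) (B (b i))
      = inner 𝕜 (A (b i)) (B (b i)) - inner 𝕜 (K.starProjection (A (b i))) (B (b i)) := by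
    rw [Submodule.starProjection_orthogonal', ← inner_sub_left]
    rfl
  simp only [hsplit, Finset.sum_sub_distrib]
  refine (norm_sub_le _ _).trans (add_le_add_right ?_ _)
  calc ‖∑ i, inner 𝕜 (K.starProjection (A (b i))) (B (b i))‖
      ≤ ∑ i, ‖K.starProjection (A (b i))‖ * ‖B (b i)‖ :=
        norm_sum_le_of_le _ fun i _ => norm_inner_le_norm _ _
    _ ≤ √(∑ i, ‖K.starProjection (A (b i))‖ ^ 2) * √(∑ i, ‖B (b i)‖ ^ 2) :=
        Real.sum_mul_le_sqrt_mul_sqrt _ _ _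
    _ ≤ √(Module.finrank 𝕜 K) * √(∑ i, ‖B (b i)‖ ^ 2) := by
        gcongr
        exact sum_norm_sq_starProjection_apply_orthonormalBasis_le b hA K

theorem opNorm_le_sqrt_sum_norm_sq_apply (b : OrthonormalBasis ι 𝕜 E) (A : E →L[𝕜] F) :
    ‖A‖ ≤ √(∑ i, ‖A (b i)‖ ^ 2) := by
  refine A.opNorm_le_bound (Real.sqrt_nonneg _) fun x => ?_
  calc ‖A x‖ = ‖∑ i, inner 𝕜 (b i) x • A (b i)‖ := by
        conv_lhs => rw [← b.sum_repr' x, map_sum]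
        simp only [map_smul]
    _ ≤ ∑ i, ‖A (b i)‖ * ‖inner 𝕜 (b i) x‖ :=
        norm_sum_le_of_le _ fun i _ => by rw [norm_smul, mul_comm]
    _ ≤ √(∑ i, ‖A (b i)‖ ^ 2) * √(∑ i, ‖inner 𝕜 (b i) x‖ ^ 2) :=
        Real.sum_mul_le_sqrt_mul_sqrt _ _ _
    _ = √(∑ i, ‖A (b i)‖ ^ 2) * ‖x‖ := by
        rw [b.sum_sq_norm_inner_right, Real.sqrt_sq (norm_nonneg x)]

theorem sum_norm_sq_adjoint_apply_orthonormalBasis [CompleteSpace E] [CompleteSpace F]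
    (b : OrthonormalBasis ι 𝕜 E) (c : OrthonormalBasis κ 𝕜 F) (A : E →L[𝕜] F) :
    ∑ j, ‖ContinuousLinearMap.adjoint A (c j)‖ ^ 2 = ∑ i, ‖A (b i)‖ ^ 2 := by
  simp_rw [← b.sum_sq_norm_inner_left (ContinuousLinearMap.adjoint A _),
    ← c.sum_sq_norm_inner_right (A _), ContinuousLinearMap.adjoint_inner_left]
  exact Finset.sum_comm

end HilbertSchmidt

section QuadraticForm

variable {E ι : Type*} [NormedAddCommGroup E] [InnerProductSpace ℝ E] [FiniteDimensional ℝ E]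
  [Fintype ι]

theorem inner_apply_self_eq_sum_eigenvalues {S : E →L[ℝ] E} (hS : (S : E →ₗ[ℝ] E).IsSymmetric)
    (y : E) : inner ℝ y (S y)
      = ∑ i, hS.eigenvalues rfl i * inner ℝ (hS.eigenvectorBasis rfl i) y ^ 2 := by
  rw [← (hS.eigenvectorBasis rfl).sum_inner_mul_inner y (S y)]
  refine Finset.sum_congr rfl fun i _ => ?_
  have hsymm : inner ℝ (hS.eigenvectorBasis rfl i) (S y)
      = hS.eigenvalues rfl i * inner ℝ (hS.eigenvectorBasis rfl i) y := by
    rw [← ContinuousLinearMap.coe_coe, ← hS, hS.apply_eigenvectorBasis, real_inner_smul_left]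
    rfl
  rw [hsymm, real_inner_comm]
  ring

theorem abs_eigenvalues_le_opNorm {S : E →L[ℝ] E} (hS : (S : E →ₗ[ℝ] E).IsSymmetric)
    (i : Fin (Module.finrank ℝ E)) : |hS.eigenvalues rfl i| ≤ ‖S‖ := by
  have h := S.le_opNorm (hS.eigenvectorBasis rfl i)
  rwa [← ContinuousLinearMap.coe_coe, hS.apply_eigenvectorBasis, norm_smul,
    OrthonormalBasis.norm_eq_one, mul_one, mul_one, RCLike.norm_ofReal] at h

theorem sum_eigenvalues_sq_eq_sum_norm_sq_apply (b : OrthonormalBasis ι ℝ E) {S : E →L[ℝ] E}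
    (hS : (S : E →ₗ[ℝ] E).IsSymmetric) :
    ∑ i, hS.eigenvalues rfl i ^ 2 = ∑ i, ‖S (b i)‖ ^ 2 := by
  have := FiniteDimensional.complete ℝ E
  have hadj : ContinuousLinearMap.adjoint S = S :=
    ContinuousLinearMap.isSelfAdjoint_iff_isSymmetric.2 hS
  have heigen (i) : ‖S (hS.eigenvectorBasis rfl i)‖ ^ 2 = hS.eigenvalues rfl i ^ 2 := by
    rw [← ContinuousLinearMap.coe_coe, hS.apply_eigenvectorBasis, norm_smul,
      OrthonormalBasis.norm_eq_one, mul_one, RCLike.norm_ofReal, sq_abs]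
  simp only [← sum_norm_sq_adjoint_apply_orthonormalBasis b (hS.eigenvectorBasis rfl) S, hadj,
    heigen]

theorem sum_eigenvalues_eq_sum_inner_apply (b : OrthonormalBasis ι ℝ E) {S : E →L[ℝ] E}
    (hS : (S : E →ₗ[ℝ] E).IsSymmetric) :
    ∑ i, hS.eigenvalues rfl i = ∑ i, inner ℝ (b i) (S (b i)) := by
  have h := hS.trace_eq_sum_eigenvalues rfl
  rw [LinearMap.trace_eq_sum_inner _ b] at h
  exact h.symm

theorem exists_isSymmetric_inner_apply_self_eq (b : OrthonormalBasis ι ℝ E) (T : E →L[ℝ] E) :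
    ∃ S : E →L[ℝ] E, (S : E →ₗ[ℝ] E).IsSymmetric ∧ (∀ x, inner ℝ x (S x) = inner ℝ x (T x)) ∧
      ‖S‖ ≤ ‖T‖ ∧ ∑ i, ‖S (b i)‖ ^ 2 ≤ ∑ i, ‖T (b i)‖ ^ 2 := by
  have := FiniteDimensional.complete ℝ E
  let T' := ContinuousLinearMap.adjoint T
  have hnorm : ‖T'‖ = ‖T‖ := LinearIsometryEquiv.norm_map _ T
  refine ⟨(1 / 2 : ℝ) • (T + T'), fun x y => ?_, fun x => ?_, ?_, ?_⟩
  · simp only [T', ContinuousLinearMap.coe_coe, smul_apply,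
      add_apply, real_inner_smul_left, real_inner_smul_right, inner_add_left,
      inner_add_right, ContinuousLinearMap.adjoint_inner_left,
      ContinuousLinearMap.adjoint_inner_right]
    ring
  · simp only [T', smul_apply, add_apply,
      real_inner_smul_right, inner_add_right, ContinuousLinearMap.adjoint_inner_right]
    rw [real_inner_comm x (T x)]
    ring
  · rw [norm_smul, Real.norm_of_nonneg (by norm_num)]
    linarith [norm_add_le T T']
  · have hconvex (v w : E) : ‖(1 / 2 : ℝ) • (v + w)‖ ^ 2 ≤ (‖v‖ ^ 2 + ‖w‖ ^ 2) / 2 := by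
      rw [norm_smul, mul_pow, Real.norm_of_nonneg (by norm_num)]
      nlinarith [parallelogram_law_with_norm ℝ v w, sq_nonneg ‖v - w‖]
    calc ∑ i, ‖(1 / 2 : ℝ) • (T (b i) + T' (b i))‖ ^ 2
        ≤ ∑ i, (‖T (b i)‖ ^ 2 + ‖T' (b i)‖ ^ 2) / 2 :=
          Finset.sum_le_sum fun i _ => hconvex _ _
      _ = ∑ i, ‖T (b i)‖ ^ 2 := by
          rw [← Finset.sum_div, Finset.sum_add_distrib,
            sum_norm_sq_adjoint_apply_orthonormalBasis b b T]
          ring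

variable [MeasurableSpace E] [BorelSpace E]

theorem integrable_and_integral_exp_mul_inner_apply_le_of_isSymmetric
    (b : OrthonormalBasis ι ℝ E) {S : E →L[ℝ] E} (hS : (S : E →ₗ[ℝ] E).IsSymmetric) {l : ℝ}
    (hl : |l| * ‖S‖ ≤ 1 / 4) :
    Integrable (fun x => Real.exp (l * inner ℝ x (S x))) (stdGaussian E) ∧
    ∫ x, Real.exp (l * inner ℝ x (S x)) ∂(stdGaussian E) ≤
      Real.exp (l * ∑ i, inner ℝ (b i) (S (b i)) + 2 * l ^ 2 * ∑ i, ‖S (b i)‖ ^ 2) := by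
  let e := hS.eigenvectorBasis rfl
  let ν := hS.eigenvalues rfl
  have hlν (i) : |l * ν i| ≤ 1 / 4 := by
    rw [abs_mul]
    exact (mul_le_mul_of_nonneg_left (abs_eigenvalues_le_opNorm hS i) (abs_nonneg l)).trans hl
  have hproduct (x : Fin (Module.finrank ℝ E) → ℝ) :
      Real.exp (l * inner ℝ (∑ i, x i • e i) (S (∑ i, x i • e i)))
        = ∏ i, Real.exp (l * ν i * x i ^ 2) := by
    rw [← Real.exp_sum, inner_apply_self_eq_sum_eigenvalues hS, Finset.mul_sum]
    simp only [e, ν, (hS.eigenvectorBasis rfl).orthonormal.inner_right_fintype, mul_assoc]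
  have hcoord : AEMeasurable (fun x : Fin (Module.finrank ℝ E) → ℝ => ∑ i, x i • e i)
      (Measure.pi fun _ => gaussianReal 0 1) :=
    Measurable.aemeasurable (by fun_prop)
  have hexp : Continuous fun x => Real.exp (l * inner ℝ x (S x)) := by fun_prop
  rw [stdGaussian_eq_map_pi_orthonormalBasis e]
  constructor
  · rw [integrable_map_measure hexp.aestronglyMeasurable hcoord]
    refine Integrable.congr (.fintype_prod (f := fun i x => Real.exp (l * ν i * x ^ 2)) fun i =>
      integrable_exp_mul_sq_gaussianReal ?_) (.of_forall fun x => (hproduct x).symm)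
    linarith [le_of_abs_le (hlν i)]
  · rw [integral_map hcoord hexp.aestronglyMeasurable]
    simp_rw [hproduct]
    calc ∫ x, ∏ i, Real.exp (l * ν i * x i ^ 2) ∂(Measure.pi fun _ => gaussianReal 0 1)
        = ∏ i, ∫ x, Real.exp (l * ν i * x ^ 2) ∂(gaussianReal 0 1) :=
          integral_fintype_prod_eq_prod (fun i x => Real.exp (l * ν i * x ^ 2))
      _ ≤ ∏ i, Real.exp (l * ν i + 2 * (l * ν i) ^ 2) :=
          Finset.prod_le_prod (fun i _ => integral_nonneg fun _ => (Real.exp_pos _).le)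
            fun i _ => integral_exp_mul_sq_gaussianReal_le (hlν i)
      _ = Real.exp (l * ∑ i, ν i + 2 * l ^ 2 * ∑ i, ν i ^ 2) := by
          simp only [← Real.exp_sum, Finset.sum_add_distrib, Finset.mul_sum, mul_pow, mul_assoc]
      _ = _ := by
          simp only [ν, sum_eigenvalues_eq_sum_inner_apply b hS,
            sum_eigenvalues_sq_eq_sum_norm_sq_apply b hS]

theorem integrable_and_integral_exp_mul_inner_apply_le (b : OrthonormalBasis ι ℝ E)
    (T : E →L[ℝ] E) {l : ℝ} (hl : |l| * ‖T‖ ≤ 1 / 4) :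
    Integrable (fun x => Real.exp (l * inner ℝ x (T x))) (stdGaussian E) ∧
    ∫ x, Real.exp (l * inner ℝ x (T x)) ∂(stdGaussian E) ≤
      Real.exp (l * ∑ i, inner ℝ (b i) (T (b i)) + 2 * l ^ 2 * ∑ i, ‖T (b i)‖ ^ 2) := by
  obtain ⟨S, hS, hST, hnorm, hsum⟩ := exists_isSymmetric_inner_apply_self_eq b T
  have hlS : |l| * ‖S‖ ≤ 1 / 4 := (mul_le_mul_of_nonneg_left hnorm (abs_nonneg l)).trans hl
  have key := integrable_and_integral_exp_mul_inner_apply_le_of_isSymmetric b hS hlS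
  simp only [hST] at key
  exact ⟨key.1, key.2.trans (Real.exp_le_exp.2 (by gcongr))⟩

theorem stdGaussian_inner_apply_tail {F : Type*} [NormedAddCommGroup F] [InnerProductSpace ℝ F]
    [CompleteSpace F] (b : OrthonormalBasis ι ℝ E) (A B : E →L[ℝ] F) {l : ℝ} (hl₀ : 0 ≤ l)
    (hl : l * (‖A‖ * ‖B‖) ≤ 1 / 4) (r : ℝ) :
    (stdGaussian E).real {x | r ≤ inner ℝ (A x) (B x)} ≤
      Real.exp (-(l * r) + l * ∑ i, inner ℝ (A (b i)) (B (b i))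
        + 2 * l ^ 2 * (‖A‖ ^ 2 * ∑ i, ‖B (b i)‖ ^ 2)) := by
  have := FiniteDimensional.complete ℝ E
  let T : E →L[ℝ] E := ContinuousLinearMap.adjoint A ∘L B
  have hT (x) : inner ℝ x (T x) = inner ℝ (A x) (B x) :=
    ContinuousLinearMap.adjoint_inner_right A x (B x)
  have hnorm : |l| * ‖T‖ ≤ 1 / 4 := by
    refine le_trans ?_ hl
    rw [abs_of_nonneg hl₀, ← LinearIsometryEquiv.norm_map ContinuousLinearMap.adjoint A]
    exact mul_le_mul_of_nonneg_left (ContinuousLinearMap.opNorm_comp_le _ _) hl₀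
  have hsum : ∑ i, ‖T (b i)‖ ^ 2 ≤ ‖A‖ ^ 2 * ∑ i, ‖B (b i)‖ ^ 2 := by
    rw [Finset.mul_sum]
    refine Finset.sum_le_sum fun i _ => ?_
    rw [← mul_pow, ← LinearIsometryEquiv.norm_map ContinuousLinearMap.adjoint A]
    gcongr
    exact (ContinuousLinearMap.adjoint A).le_opNorm _
  obtain ⟨hint, hexp⟩ := integrable_and_integral_exp_mul_inner_apply_le b T hnorm
  simp only [hT] at hint hexp
  calc (stdGaussian E).real {x | r ≤ inner ℝ (A x) (B x)}
      ≤ Real.exp (-l * r) * ∫ x, Real.exp (l * inner ℝ (A x) (B x)) ∂(stdGaussian E) :=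
        measure_ge_le_exp_mul_mgf r hl₀ hint
    _ ≤ Real.exp (-l * r) * Real.exp (l * ∑ i, inner ℝ (A (b i)) (B (b i))
          + 2 * l ^ 2 * (‖A‖ ^ 2 * ∑ i, ‖B (b i)‖ ^ 2)) := by
        refine mul_le_mul_of_nonneg_left (hexp.trans (Real.exp_le_exp.2 ?_)) (Real.exp_pos _).le
        gcongr
    _ = _ := by
        rw [← Real.exp_add]
        ring_nf

end QuadraticForm

section ComplexGaussian

variable {ι W : Type*} [Fintype ι] [NormedAddCommGroup W] [InnerProductSpace ℂ W]

/-- The real orthonormal basis of `ℂ^ι` formed by the vectors `e j` and `i e j`. It identifies the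
standard real Gaussian measure of `ℂ^ι` with the law of a vector of standard complex Gaussians. -/
noncomputable def realBasis (ι : Type*) [Fintype ι] :
    OrthonormalBasis ((_ : ι) × Fin 2) ℝ (EuclideanSpace ℂ ι) :=
  Pi.orthonormalBasis fun _ => Complex.orthonormalBasisOneI

theorem realBasis_zero (j : ι) : realBasis ι ⟨j, 0⟩ = EuclideanSpace.basisFun ι ℂ j := by
  classical
  simp [realBasis, Pi.orthonormalBasis_apply, EuclideanSpace.basisFun_apply]

theorem realBasis_one (j : ι) :
    realBasis ι ⟨j, 1⟩ = Complex.I • EuclideanSpace.basisFun ι ℂ j := by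
  classical
  ext i
  simp [realBasis, Pi.orthonormalBasis_apply, EuclideanSpace.basisFun_apply]

theorem sum_norm_sq_apply_realBasis (A : EuclideanSpace ℂ ι →L[ℂ] W) :
    ∑ p, ‖A (realBasis ι p)‖ ^ 2 = 2 * ∑ j, ‖A (EuclideanSpace.basisFun ι ℂ j)‖ ^ 2 := by
  simp only [Fintype.sum_sigma, Fin.sum_univ_two, realBasis_zero, realBasis_one, map_smul,
    norm_smul, Complex.norm_I, one_mul, ← two_mul, Finset.mul_sum]

theorem sum_inner_apply_realBasis (A B : EuclideanSpace ℂ ι →L[ℂ] W) :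
    ∑ p, inner ℂ (A (realBasis ι p)) (B (realBasis ι p))
      = 2 * ∑ j, inner ℂ (A (EuclideanSpace.basisFun ι ℂ j))
          (B (EuclideanSpace.basisFun ι ℂ j)) := by
  have hI (v w : W) : inner ℂ (Complex.I • v) (Complex.I • w) = inner ℂ v w := by
    rw [inner_smul_left, inner_smul_right, ← mul_assoc, Complex.conj_I, neg_mul, Complex.I_mul_I,
      neg_neg, one_mul]
  simp only [Fintype.sum_sigma, Fin.sum_univ_two, realBasis_zero, realBasis_one, map_smul, hI,
    ← two_mul, Finset.mul_sum]

theorem stdGaussian_re_inner_apply_tail [CompleteSpace W] (A B : EuclideanSpace ℂ ι →L[ℂ] W)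
    {l : ℝ} (hl₀ : 0 ≤ l) (hl : l * (‖A‖ * ‖B‖) ≤ 1 / 4) (r : ℝ) :
    (stdGaussian (EuclideanSpace ℂ ι)).real {w | r ≤ (inner ℂ (A w) (B w)).re} ≤
      Real.exp (-(l * r)
        + 2 * l * (∑ j, inner ℂ (A (EuclideanSpace.basisFun ι ℂ j))
            (B (EuclideanSpace.basisFun ι ℂ j))).re
        + 4 * l ^ 2 * ‖A‖ ^ 2 * ∑ j, ‖B (EuclideanSpace.basisFun ι ℂ j)‖ ^ 2) := by
  let _ : InnerProductSpace ℝ W := InnerProductSpace.complexToReal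
  have htrace : ∑ p, (inner ℂ (A (realBasis ι p)) (B (realBasis ι p))).re
      = 2 * (∑ j, inner ℂ (A (EuclideanSpace.basisFun ι ℂ j))
          (B (EuclideanSpace.basisFun ι ℂ j))).re := by
    rw [← Complex.re_sum, sum_inner_apply_realBasis, ← Complex.ofReal_ofNat, Complex.re_ofReal_mul]
  refine (stdGaussian_inner_apply_tail (realBasis ι) (A.restrictScalars ℝ) (B.restrictScalars ℝ)
    hl₀ (by simpa only [ContinuousLinearMap.norm_restrictScalars] using hl) r).trans_eq ?_
  simp only [ContinuousLinearMap.norm_restrictScalars, ContinuousLinearMap.coe_restrictScalars',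
    sum_norm_sq_apply_realBasis]
  congr 2
  · rw [mul_comm 2 l, mul_assoc, ← htrace]
    rfl
  · ring

theorem stdGaussian_norm_sq_apply_tail [CompleteSpace W] (A : EuclideanSpace ℂ ι →L[ℂ] W)
    {p V : ℝ} (hp : 0 < p) (hA : ‖A‖ ≤ p)
    (hV : ∑ j, ‖A (EuclideanSpace.basisFun ι ℂ j)‖ ^ 2 ≤ V) {β : ℝ} (hβ : 0 < β) :
    (stdGaussian (EuclideanSpace ℂ ι)).real {w | 4 * (V + p ^ 2 * Real.log (1 / β)) ≤ ‖A w‖ ^ 2}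
      ≤ β := by
  have hself (v : W) : (inner ℂ v v).re = ‖v‖ ^ 2 := (norm_sq_eq_re_inner (𝕜 := ℂ) v).symm
  have hV₀ : 0 ≤ V := (Finset.sum_nonneg fun j _ => sq_nonneg _).trans hV
  have htail := stdGaussian_re_inner_apply_tail A A (l := 1 / (4 * p ^ 2)) (by positivity)
    (by rw [div_mul_eq_mul_div, div_le_iff₀ (by positivity)]
        nlinarith [mul_le_mul hA hA (norm_nonneg A) hp.le])
    (4 * (V + p ^ 2 * Real.log (1 / β)))
  simp only [hself, Complex.re_sum] at htail
  refine htail.trans ((Real.le_log_iff_exp_le hβ).1 ?_)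
  calc _ ≤ -(1 / (4 * p ^ 2) * (4 * (V + p ^ 2 * Real.log (1 / β))))
          + 2 * (1 / (4 * p ^ 2)) * V + 4 * (1 / (4 * p ^ 2)) ^ 2 * p ^ 2 * V := by gcongr
    _ = Real.log β - V / (4 * p ^ 2) := by
        rw [one_div β, Real.log_inv]
        field_simp
        ring
    _ ≤ Real.log β := sub_le_self _ (by positivity)

theorem stdGaussian_norm_sq_apply_tail_hilbertSchmidt [CompleteSpace W]
    (A : EuclideanSpace ℂ ι →L[ℂ] W) {V : ℝ}
    (hV : ∑ j, ‖A (EuclideanSpace.basisFun ι ℂ j)‖ ^ 2 ≤ V) {β : ℝ} (hβ : 0 < β) :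
    (stdGaussian (EuclideanSpace ℂ ι)).real {w | 4 * V * (1 + Real.log (1 / β)) < ‖A w‖ ^ 2}
      ≤ β := by
  have hV₀ : 0 ≤ V := (Finset.sum_nonneg fun j _ => sq_nonneg _).trans hV
  have hA : ‖A‖ ≤ √V :=
    (opNorm_le_sqrt_sum_norm_sq_apply (EuclideanSpace.basisFun ι ℂ) A).trans (Real.sqrt_le_sqrt hV)
  rcases hV₀.eq_or_lt with rfl | hV_pos
  · have hA₀ : A = 0 := norm_le_zero_iff.1 (hA.trans_eq Real.sqrt_zero)
    simpa [hA₀] using hβ.le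
  · refine (measureReal_mono fun w hw => ?_).trans
      (stdGaussian_norm_sq_apply_tail A (Real.sqrt_pos.2 hV_pos) hA hV hβ)
    simp only [Set.mem_ofPred_eq, Real.sq_sqrt hV₀] at hw ⊢
    linarith

theorem stdGaussian_re_inner_apply_tail_of_contraction [CompleteSpace W]
    (A B : EuclideanSpace ℂ ι →L[ℂ] W) {V τ : ℝ} (hV₀ : 0 < V) (hA : ‖A‖ ≤ 1)
    (hV : ∑ j, ‖B (EuclideanSpace.basisFun ι ℂ j)‖ ^ 2 ≤ V)
    (hτ : (∑ j, inner ℂ (A (EuclideanSpace.basisFun ι ℂ j))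
      (B (EuclideanSpace.basisFun ι ℂ j))).re ≤ τ) {β : ℝ} (hβ : 0 < β) :
    (stdGaussian (EuclideanSpace ℂ ι)).real
      {w | 2 * τ + 4 * √V * (1 + Real.log (1 / β)) ≤ (inner ℂ (A w) (B w)).re} ≤ β := by
  have hB : ‖B‖ ≤ √V :=
    (opNorm_le_sqrt_sum_norm_sq_apply (EuclideanSpace.basisFun ι ℂ) B).trans (Real.sqrt_le_sqrt hV)
  refine (stdGaussian_re_inner_apply_tail A B (l := 1 / (4 * √V)) (by positivity)
    (by rw [div_mul_eq_mul_div, div_le_iff₀ (by positivity)]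
        nlinarith [mul_le_mul hA hB (norm_nonneg B) zero_le_one]) _).trans
    ((Real.le_log_iff_exp_le hβ).1 ?_)
  calc _ ≤ -(1 / (4 * √V) * (2 * τ + 4 * √V * (1 + Real.log (1 / β))))
          + 2 * (1 / (4 * √V)) * τ + 4 * (1 / (4 * √V)) ^ 2 * 1 ^ 2 * √V ^ 2 := by
        rw [Real.sq_sqrt hV₀.le]
        gcongr
    _ = Real.log β - 3 / 4 := by
        rw [one_div β, Real.log_inv]
        field_simp
        ring
    _ ≤ Real.log β := by linarith

theorem exists_unit_le_re_mul_of_two_mul_lt_norm {R : ℝ} {u : ℂ} (h : 2 * R < ‖u‖) :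
    ∃ c ∈ ({1, -1, Complex.I, -Complex.I} : Finset ℂ), R ≤ (c * u).re := by
  by_contra! hlt
  simp only [Finset.mem_insert, Finset.mem_singleton, forall_eq_or_imp, forall_eq, one_mul,
    neg_mul, Complex.neg_re, Complex.I_mul_re, neg_neg] at hlt
  obtain ⟨hre, hre', him', him⟩ := hlt
  have hre_abs : |u.re| < R := abs_lt.2 ⟨by linarith, hre⟩
  have him_abs : |u.im| < R := abs_lt.2 ⟨by linarith, him⟩
  linarith [Complex.norm_le_abs_re_add_abs_im u]

theorem stdGaussian_norm_inner_apply_tail [CompleteSpace W] (A B : EuclideanSpace ℂ ι →L[ℂ] W)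
    {V τ : ℝ} (hV₀ : 0 < V) (hA : ‖A‖ ≤ 1)
    (hV : ∑ j, ‖B (EuclideanSpace.basisFun ι ℂ j)‖ ^ 2 ≤ V)
    (hτ : ‖∑ j, inner ℂ (A (EuclideanSpace.basisFun ι ℂ j))
      (B (EuclideanSpace.basisFun ι ℂ j))‖ ≤ τ) {β : ℝ} (hβ : 0 < β) :
    (stdGaussian (EuclideanSpace ℂ ι)).real
      {w | 4 * τ + 8 * √V * (1 + Real.log (1 / β)) < ‖inner ℂ (A w) (B w)‖} ≤ 4 * β := by
  let U : Finset ℂ := {1, -1, Complex.I, -Complex.I}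
  let R : ℝ := 2 * τ + 4 * √V * (1 + Real.log (1 / β))
  have hunit : ∀ c ∈ U, ‖c‖ = 1 := by simp [U]
  have htail : ∀ c ∈ U, (stdGaussian (EuclideanSpace ℂ ι)).real
      {w | R ≤ (c * inner ℂ (A w) (B w)).re} ≤ β := fun c hc => by
    have hV' : ∑ j, ‖(c • B) (EuclideanSpace.basisFun ι ℂ j)‖ ^ 2 ≤ V := by
      simpa only [smul_apply, norm_smul, hunit c hc, one_mul] using hV
    have hτ' : (∑ j, inner ℂ (A (EuclideanSpace.basisFun ι ℂ j))
        ((c • B) (EuclideanSpace.basisFun ι ℂ j))).re ≤ τ := by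
      simp only [smul_apply, inner_smul_right, ← Finset.mul_sum]
      refine (Complex.re_le_norm _).trans ?_
      rwa [norm_mul, hunit c hc, one_mul]
    simpa only [smul_apply, inner_smul_right] using
      stdGaussian_re_inner_apply_tail_of_contraction A (c • B) hV₀ hA hV' hτ' hβ
  have hcover : {w | 4 * τ + 8 * √V * (1 + Real.log (1 / β)) < ‖inner ℂ (A w) (B w)‖}
      ⊆ ⋃ c ∈ U, {w | R ≤ (c * inner ℂ (A w) (B w)).re} := fun w hw => by
    obtain ⟨c, hc, hle⟩ := exists_unit_le_re_mul_of_two_mul_lt_norm (R := R)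
      (u := inner ℂ (A w) (B w)) (lt_of_eq_of_lt (by ring) hw)
    exact Set.mem_biUnion hc hle
  calc _ ≤ ∑ c ∈ U, (stdGaussian (EuclideanSpace ℂ ι)).real
          {w | R ≤ (c * inner ℂ (A w) (B w)).re} :=
        (measureReal_mono hcover (measure_ne_top _ _)).trans (measureReal_biUnion_finset_le _ _)
    _ ≤ U.card • β := Finset.sum_le_card_nsmul _ _ _ htail
    _ ≤ 4 * β := by
        rw [nsmul_eq_mul]
        gcongr
        exact_mod_cast Finset.card_le_four

end ComplexGaussian

/-! ### Finitely supported filters -/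

theorem seqSupportedOn_mono {a b a' b' : ℤ} (ha : a' ≤ a) (hb : b ≤ b') :
    seqSupportedOn a b ⊆ seqSupportedOn a' b' := fun _ hu t ht =>
  hu t fun h => ht ⟨ha.trans h.1, h.2.trans hb⟩

theorem shiftSeq_mem_seqSupportedOn {u : ℤ → ℂ} {a b : ℤ} (hu : u ∈ seqSupportedOn a b) (k : ℤ) :
    shiftSeq k u ∈ seqSupportedOn (a + k) (b + k) := fun t ht =>
  hu (t - k) fun h => ht ⟨by linarith [h.1], by linarith [h.2]⟩

theorem sum_Icc_shift {M : Type*} [AddCommMonoid M] (f : ℤ → M) (a b k : ℤ) :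
    ∑ t ∈ Finset.Icc a b, f (t - k) = ∑ i ∈ Finset.Icc (a - k) (b - k), f i :=
  Finset.sum_equiv (Equiv.subRight k) (by simp) (by simp)

theorem sum_Icc_reflect {M : Type*} [AddCommMonoid M] (f : ℤ → M) (a b t : ℤ) :
    ∑ τ ∈ Finset.Icc a b, f (t - τ) = ∑ i ∈ Finset.Icc (t - b) (t - a), f i :=
  Finset.sum_equiv (Equiv.subLeft t)
    (by intro i; simp only [Finset.mem_Icc, Equiv.subLeft_apply]; omega) (by simp)

theorem sum_range_eq_sum_Icc {M : Type*} [AddCommMonoid M] (f : ℤ → M) (n : ℕ) :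
    ∑ t ∈ Finset.range (n + 1), f t = ∑ t ∈ Finset.Icc (0 : ℤ) n, f t := by
  refine Finset.sum_bij' (fun t _ => (t : ℤ)) (fun i _ => i.toNat) ?_ ?_ ?_ ?_ ?_ <;>
    simp only [Finset.mem_Icc, Finset.mem_range] <;> intros <;> first | omega | trivial

theorem card_Icc_add (n : ℕ) (a : ℤ) : ((Finset.Icc a (n + a)).card : ℝ) = n + 1 := by
  rw [Int.card_Icc, add_right_comm, add_sub_cancel_right]
  exact_mod_cast rfl

theorem sum_norm_sq_le_sum_Icc_of_mem_seqSupportedOn {u : ℤ → ℂ} {a b : ℤ}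
    (hu : u ∈ seqSupportedOn a b) (J : Finset ℤ) :
    ∑ t ∈ J, ‖u t‖ ^ 2 ≤ ∑ t ∈ Finset.Icc a b, ‖u t‖ ^ 2 := by
  rw [← Finset.sum_filter_of_ne (s := J) (p := (· ∈ Finset.Icc a b))]
  · exact Finset.sum_le_sum_of_subset_of_nonneg (fun t ht => (Finset.mem_filter.1 ht).2)
      fun _ _ _ => sq_nonneg _
  · intro t _ ht
    contrapose! ht
    rw [hu t fun h => ht (Finset.mem_Icc.2 h), norm_zero, zero_pow two_ne_zero]

theorem convSeq_eq_sum {u : ℤ → ℂ} {a b : ℤ} (hu : u ∈ seqSupportedOn a b) {J : Finset ℤ}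
    (hJ : Finset.Icc a b ⊆ J) (v : ℤ → ℂ) (t : ℤ) :
    convSeq u v t = ∑ τ ∈ J, u τ * v (t - τ) := by
  refine tsum_eq_sum fun τ hτ => ?_
  rw [hu τ fun h => hτ (hJ (Finset.mem_Icc.2 h)), zero_mul]

theorem convSeq_eq_sum_reflect {u : ℤ → ℂ} {a b : ℤ} (hu : u ∈ seqSupportedOn a b)
    {J : Finset ℤ} {t : ℤ} (hJ : Finset.Icc (t - b) (t - a) ⊆ J) (v : ℤ → ℂ) :
    convSeq u v t = ∑ j ∈ J, u (t - j) * v j := by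
  have hreflect := sum_Icc_reflect (fun j => u (t - j) * v j) a b t
  simp only [sub_sub_cancel] at hreflect
  rw [convSeq_eq_sum hu subset_rfl, hreflect]
  refine Finset.sum_subset hJ fun j _ hj => ?_
  rw [hu (t - j) fun h => hj (Finset.mem_Icc.2 ⟨by linarith [h.2], by linarith [h.1]⟩), zero_mul]

theorem convSeq_mem_seqSupportedOn {u v : ℤ → ℂ} {a b c d : ℤ} (hu : u ∈ seqSupportedOn a b)
    (hv : v ∈ seqSupportedOn c d) : convSeq u v ∈ seqSupportedOn (a + c) (b + d) := by
  intro t ht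
  rw [convSeq_eq_sum hu subset_rfl]
  refine Finset.sum_eq_zero fun τ hτ => ?_
  rw [Finset.mem_Icc] at hτ
  rw [hv (t - τ) fun h => ht ⟨by linarith [h.1], by linarith [h.2]⟩, mul_zero]

theorem isLinearMap_convSeq {u : ℤ → ℂ} {a b : ℤ} (hu : u ∈ seqSupportedOn a b) :
    IsLinearMap ℂ (convSeq u) where
  map_add v w := by
    funext t
    simp only [Pi.add_apply, convSeq_eq_sum hu subset_rfl, mul_add, Finset.sum_add_distrib]
  map_smul c v := by
    funext t
    simp only [Pi.smul_apply, smul_eq_mul, convSeq_eq_sum hu subset_rfl, Finset.mul_sum,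
      mul_left_comm]

theorem sub_convSeq {u w : ℤ → ℂ} {a b : ℤ} (hu : u ∈ seqSupportedOn a b)
    (hw : w ∈ seqSupportedOn a b) (v : ℤ → ℂ) :
    convSeq (u - w) v = convSeq u v - convSeq w v := by
  have huw : u - w ∈ seqSupportedOn a b := fun t ht => by
    rw [Pi.sub_apply, hu t ht, hw t ht, sub_zero]
  funext t
  simp only [Pi.sub_apply, convSeq_eq_sum hu subset_rfl, convSeq_eq_sum hw subset_rfl,
    convSeq_eq_sum huw subset_rfl, sub_mul, Finset.sum_sub_distrib]

theorem convSeq_left_comm {u w : ℤ → ℂ} {a b c d : ℤ} (hu : u ∈ seqSupportedOn a b)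
    (hw : w ∈ seqSupportedOn c d) (v : ℤ → ℂ) :
    convSeq u (convSeq w v) = convSeq w (convSeq u v) := by
  funext t
  simp only [convSeq_eq_sum hu subset_rfl, convSeq_eq_sum hw subset_rfl, Finset.mul_sum]
  rw [Finset.sum_comm]
  simp only [sub_right_comm, mul_left_comm]

theorem convSeq_assoc {u w : ℤ → ℂ} {a b c d : ℤ} (hu : u ∈ seqSupportedOn a b)
    (hw : w ∈ seqSupportedOn c d) (v : ℤ → ℂ) :
    convSeq (convSeq u w) v = convSeq u (convSeq w v) := by
  funext t
  rw [convSeq_eq_sum (convSeq_mem_seqSupportedOn hu hw) subset_rfl]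
  simp only [convSeq_eq_sum hu subset_rfl, Finset.sum_mul]
  rw [Finset.sum_comm]
  refine Finset.sum_congr rfl fun i hi => ?_
  rw [Finset.mem_Icc] at hi
  have hshift := sum_Icc_shift (fun s => u i * w s * v (t - i - s)) (a + c) (b + d) i
  simp only [sub_sub, add_sub_cancel] at hshift
  rw [hshift, convSeq_eq_sum hw (J := Finset.Icc (a + c - i) (b + d - i))
    (Finset.Icc_subset_Icc (by linarith) (by linarith)), Finset.mul_sum]
  simp only [mul_assoc, sub_sub]

theorem convSeq_shiftSeq_shiftSeq (h k : ℤ) (u v : ℤ → ℂ) :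
    convSeq (shiftSeq h u) (shiftSeq k v) = shiftSeq (h + k) (convSeq u v) := by
  funext t
  simp only [convSeq, shiftSeq]
  rw [← (Equiv.addRight h).tsum_eq fun τ => u (τ - h) * v (t - τ - k)]
  simp only [Equiv.coe_addRight, add_sub_cancel_right, sub_add_eq_sub_sub, sub_right_comm]

theorem norm_convSeq_sq_le {u : ℤ → ℂ} {a b : ℤ} (hu : u ∈ seqSupportedOn a b) (v : ℤ → ℂ)
    (t : ℤ) : ‖convSeq u v t‖ ^ 2 ≤
      (∑ τ ∈ Finset.Icc a b, ‖u τ‖ ^ 2) * ∑ j ∈ Finset.Icc (t - b) (t - a), ‖v j‖ ^ 2 := by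
  rw [convSeq_eq_sum hu subset_rfl, ← sum_Icc_reflect (fun j => ‖v j‖ ^ 2)]
  calc ‖∑ τ ∈ Finset.Icc a b, u τ * v (t - τ)‖ ^ 2
      ≤ (∑ τ ∈ Finset.Icc a b, ‖u τ‖ * ‖v (t - τ)‖) ^ 2 := by
        gcongr
        exact norm_sum_le_of_le _ fun τ _ => norm_mul_le _ _
    _ ≤ _ := Finset.sum_mul_sq_le_sq_mul_sq _ _ _

theorem measurable_convSeq {u : ℤ → ℂ} {a b : ℤ} (hu : u ∈ seqSupportedOn a b) :
    Measurable (convSeq u) := by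
  refine measurable_pi_lambda _ fun t => ?_
  simp only [convSeq_eq_sum hu subset_rfl]
  fun_prop

/-! ### Windows and Toeplitz sections -/

/-- The restriction of a sequence to a finite set of times, as a vector of a Hilbert space. -/
noncomputable def window (T : Finset ℤ) : (ℤ → ℂ) →ₗ[ℂ] EuclideanSpace ℂ T where
  toFun u := WithLp.toLp 2 fun t => u t
  map_add' _ _ := rfl
  map_smul' _ _ := rfl

theorem window_apply (T : Finset ℤ) (u : ℤ → ℂ) (t : T) : window T u t = u t := rfl

theorem norm_window_sq (T : Finset ℤ) (u : ℤ → ℂ) : ‖window T u‖ ^ 2 = ∑ t ∈ T, ‖u t‖ ^ 2 := by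
  rw [EuclideanSpace.norm_sq_eq]
  exact Finset.sum_coe_sort T fun t => ‖u t‖ ^ 2

theorem windowNorm_shiftSeq (n : ℕ) (h : ℤ) (u : ℤ → ℂ) :
    windowNorm n (shiftSeq (-h) u) = ‖window (Finset.Icc h (n + h)) u‖ := by
  rw [windowNorm, sum_range_eq_sum_Icc fun t => ‖shiftSeq (-h) u t‖ ^ 2,
    ← Real.sqrt_sq (norm_nonneg (window _ u)), norm_window_sq]
  simp only [shiftSeq]
  rw [sum_Icc_shift fun t => ‖u t‖ ^ 2, zero_sub, neg_neg, sub_neg_eq_add]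

theorem measurable_window (T : Finset ℤ) : Measurable (window T) :=
  (WithLp.measurable_toLp 2 _).comp (measurable_pi_lambda _ fun t => measurable_pi_apply (t : ℤ))

/-- The projection of `ℂ^J` onto the coordinates in `T ⊆ J`. -/
noncomputable def restrictWindow {T J : Finset ℤ} (hTJ : T ⊆ J) :
    EuclideanSpace ℂ J →L[ℂ] EuclideanSpace ℂ T :=
  LinearMap.toContinuousLinearMap
    { toFun := fun w => WithLp.toLp 2 fun t => w ⟨t, hTJ t.2⟩
      map_add' := fun _ _ => rfl
      map_smul' := fun _ _ => rfl }

theorem restrictWindow_apply {T J : Finset ℤ} (hTJ : T ⊆ J) (w : EuclideanSpace ℂ J) (t : T) :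
    restrictWindow hTJ w t = w ⟨t, hTJ t.2⟩ := rfl

theorem restrictWindow_window {T J : Finset ℤ} (hTJ : T ⊆ J) (u : ℤ → ℂ) :
    restrictWindow hTJ (window J u) = window T u := rfl

theorem norm_restrictWindow_le {T J : Finset ℤ} (hTJ : T ⊆ J) : ‖restrictWindow hTJ‖ ≤ 1 := by
  refine ContinuousLinearMap.opNorm_le_bound _ zero_le_one fun w => ?_
  have hinj : Function.Injective fun t : T => (⟨t, hTJ t.2⟩ : J) := fun _ _ h =>
    Subtype.ext (congrArg (fun j : J => (j : ℤ)) h)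
  rw [one_mul, ← sq_le_sq₀ (norm_nonneg _) (norm_nonneg _), EuclideanSpace.norm_sq_eq,
    EuclideanSpace.norm_sq_eq]
  simp only [restrictWindow_apply]
  rw [← Finset.sum_image (f := fun j : J => ‖w j‖ ^ 2) hinj.injOn]
  exact Finset.sum_le_univ_sum_of_nonneg fun _ => sq_nonneg _

/-- The section `ℂ^J → ℂ^T` of the Toeplitz operator `z ↦ u * z`. -/
noncomputable def toeplitzSection (u : ℤ → ℂ) (J T : Finset ℤ) :
    EuclideanSpace ℂ J →L[ℂ] EuclideanSpace ℂ T :=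
  LinearMap.toContinuousLinearMap (Matrix.toLpLin 2 2 (Matrix.of fun (t : T) (j : J) => u (t - j)))

theorem toeplitzSection_apply (u : ℤ → ℂ) (J T : Finset ℤ) (w : EuclideanSpace ℂ J) (t : T) :
    toeplitzSection u J T w t = ∑ j : J, u (t - j) * w j := rfl

theorem toeplitzSection_basisFun (u : ℤ → ℂ) (J T : Finset ℤ) (j : J) (t : T) :
    toeplitzSection u J T (EuclideanSpace.basisFun J ℂ j) t = u (t - j) := by
  simp [toeplitzSection_apply, EuclideanSpace.basisFun_apply]

theorem toeplitzSection_window {u : ℤ → ℂ} {a b : ℤ} (hu : u ∈ seqSupportedOn a b) {J T : Finset ℤ}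
    (hJ : ∀ t ∈ T, Finset.Icc (t - b) (t - a) ⊆ J) (z : ℤ → ℂ) :
    toeplitzSection u J T (window J z) = window T (convSeq u z) := by
  ext t
  rw [toeplitzSection_apply, window_apply, convSeq_eq_sum_reflect hu (hJ t t.2)]
  exact Finset.sum_coe_sort J fun j => u (t - j) * z j

theorem sum_norm_sq_toeplitzSection_basisFun_le {u : ℤ → ℂ} {a b : ℤ}
    (hu : u ∈ seqSupportedOn a b) (J T : Finset ℤ) :
    ∑ j, ‖toeplitzSection u J T (EuclideanSpace.basisFun J ℂ j)‖ ^ 2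
      ≤ T.card * ∑ τ ∈ Finset.Icc a b, ‖u τ‖ ^ 2 := by
  have hrow (t : ℤ) : ∑ j ∈ J, ‖u (t - j)‖ ^ 2 ≤ ∑ τ ∈ Finset.Icc a b, ‖u τ‖ ^ 2 := by
    refine le_of_eq_of_le ?_ (sum_norm_sq_le_sum_Icc_of_mem_seqSupportedOn hu
      (J.image fun j => t - j))
    exact (Finset.sum_image (f := fun τ => ‖u τ‖ ^ 2) (sub_right_injective (b := t)).injOn).symm
  simp only [EuclideanSpace.norm_sq_eq, toeplitzSection_basisFun]
  rw [Finset.sum_comm, ← nsmul_eq_mul, ← Fintype.card_coe, ← Finset.card_univ]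
  refine Finset.sum_le_card_nsmul _ _ _ fun t _ => ?_
  rw [Finset.sum_coe_sort J fun j => ‖u (t - j)‖ ^ 2]
  exact hrow t

theorem sum_inner_restrictWindow_toeplitzSection (u : ℤ → ℂ) {J T : Finset ℤ} (hTJ : T ⊆ J) :
    ∑ j, inner ℂ (restrictWindow hTJ (EuclideanSpace.basisFun J ℂ j))
      (toeplitzSection u J T (EuclideanSpace.basisFun J ℂ j)) = T.card * u 0 := by
  simp only [PiLp.inner_apply, restrictWindow_apply, toeplitzSection_basisFun]
  rw [Finset.sum_comm]
  simp [EuclideanSpace.basisFun_apply]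

/-! ### Noise events -/

section Noise

variable {Ω : Type*} [MeasurableSpace Ω] {μ : Measure Ω} {ζ : ℤ → Ω → ℂ}

theorem IsStdComplexGaussianNoise.measurable_path (hζ : IsStdComplexGaussianNoise μ ζ) :
    Measurable fun ω t => ζ t ω := measurable_pi_lambda _ hζ.measurable

theorem IsStdComplexGaussianNoise.map_window (hζ : IsStdComplexGaussianNoise μ ζ)
    (J : Finset ℤ) :
    μ.map (fun ω => window J fun t => ζ t ω) = stdGaussian (EuclideanSpace ℂ J) := by
  let X (p : (_ : J) × Fin 2) (ω : Ω) : ℝ :=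
    if decide (p.2 = 0) then (ζ p.1 ω).re else (ζ p.1 ω).im
  have hX (p) : Measurable (X p) ∧ μ.map (X p) = gaussianReal 0 1 := by
    have hmeas := hζ.measurable p.1
    rcases p with ⟨j, i⟩
    fin_cases i
    · exact ⟨Complex.measurable_re.comp hmeas, hζ.law_re j⟩
    · exact ⟨Complex.measurable_im.comp hmeas, hζ.law_im j⟩
  have hinj : Function.Injective fun p : (_ : J) × Fin 2 => ((p.1 : ℤ), decide (p.2 = 0)) := by
    rintro ⟨j, i⟩ ⟨j', i'⟩ h
    obtain ⟨hj, hi⟩ := Prod.mk.inj h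
    obtain rfl : j = j' := Subtype.ext hj
    fin_cases i <;> fin_cases i' <;> simp_all
  have hpi : μ.map (fun ω p => X p ω) = Measure.pi fun _ => gaussianReal 0 1 := by
    rw [(hζ.indep.precomp hinj).map_fun_eq_pi_map fun p => (hX p).1.aemeasurable]
    exact congrArg Measure.pi (funext fun p => (hX p).2)
  rw [stdGaussian_eq_map_pi_orthonormalBasis (realBasis J), ← hpi,
    Measure.map_map (by fun_prop) (measurable_pi_lambda _ fun p => (hX p).1)]
  congr 1
  funext ω
  ext j
  simp [Fintype.sum_sigma, realBasis_zero, realBasis_one, window_apply,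
    EuclideanSpace.basisFun_apply, Finset.sum_add_distrib, Pi.single_apply, Complex.re_add_im]

/-- `G` is a measurable set of noise realizations of probability at least `1 - β`. -/
def IsNoiseEvent (μ : Measure Ω) (ζ : ℤ → Ω → ℂ) (β : ℝ) (G : Set (ℤ → ℂ)) : Prop :=
  MeasurableSet G ∧ 1 - β ≤ μ.real {ω | (fun t => ζ t ω) ∈ G}

theorem IsNoiseEvent.mono {β β' : ℝ} {G : Set (ℤ → ℂ)} (h : IsNoiseEvent μ ζ β G) (hβ : β ≤ β') :
    IsNoiseEvent μ ζ β' G := ⟨h.1, by linarith [h.2]⟩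

variable [IsProbabilityMeasure μ]

theorem IsNoiseEvent.sublevel_mono {β R R' : ℝ} {f : (ℤ → ℂ) → ℝ} (hf : Measurable f)
    (h : IsNoiseEvent μ ζ β {z | f z ≤ R}) (hR : R ≤ R') : IsNoiseEvent μ ζ β {z | f z ≤ R'} :=
  ⟨measurableSet_le hf measurable_const,
    h.2.trans (measureReal_mono fun _ hω => le_trans hω hR)⟩

theorem isNoiseEvent_iff_compl (hζ : Measurable fun ω t => ζ t ω) {β : ℝ} {G : Set (ℤ → ℂ)} :
    IsNoiseEvent μ ζ β G ↔ MeasurableSet G ∧ μ.real {ω | (fun t => ζ t ω) ∉ G} ≤ β := by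
  refine and_congr_right fun hG => ?_
  have hcompl : μ.real {ω | (fun t => ζ t ω) ∉ G} = 1 - μ.real {ω | (fun t => ζ t ω) ∈ G} :=
    probReal_compl_eq_one_sub (hζ hG)
  rw [hcompl, sub_le_comm]

theorem IsNoiseEvent.inter (hζ : Measurable fun ω t => ζ t ω) {β β' : ℝ} {G G' : Set (ℤ → ℂ)}
    (h : IsNoiseEvent μ ζ β G) (h' : IsNoiseEvent μ ζ β' G') :
    IsNoiseEvent μ ζ (β + β') (G ∩ G') := by
  rw [isNoiseEvent_iff_compl hζ] at *
  refine ⟨h.1.inter h'.1, ?_⟩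
  calc μ.real {ω | (fun t => ζ t ω) ∉ G ∩ G'}
      = μ.real ({ω | (fun t => ζ t ω) ∉ G} ∪ {ω | (fun t => ζ t ω) ∉ G'}) := by
        congr 1
        ext ω
        exact not_and_or
    _ ≤ β + β' := (measureReal_union_le _ _).trans (add_le_add h.2 h'.2)

theorem IsNoiseEvent.biInter (hζ : Measurable fun ω t => ζ t ω) {κ : Type*} (I : Finset κ)
    {β : ℝ} {G : κ → Set (ℤ → ℂ)} (h : ∀ i ∈ I, IsNoiseEvent μ ζ β (G i)) :
    IsNoiseEvent μ ζ (I.card * β) (⋂ i ∈ I, G i) := by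
  simp only [isNoiseEvent_iff_compl hζ] at *
  refine ⟨Finset.measurableSet_biInter I fun i hi => (h i hi).1, ?_⟩
  calc μ.real {ω | (fun t => ζ t ω) ∉ ⋂ i ∈ I, G i}
      = μ.real (⋃ i ∈ I, {ω | (fun t => ζ t ω) ∉ G i}) := by
        congr 1
        ext ω
        simp
    _ ≤ ∑ i ∈ I, μ.real {ω | (fun t => ζ t ω) ∉ G i} := measureReal_biUnion_finset_le _ _
    _ ≤ I.card * β := by
        rw [← nsmul_eq_mul]
        exact Finset.sum_le_card_nsmul _ _ _ fun i hi => (h i hi).2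

theorem IsStdComplexGaussianNoise.isNoiseEvent_of_stdGaussian
    (hζ : IsStdComplexGaussianNoise μ ζ) {J : Finset ℤ} {f : EuclideanSpace ℂ J → ℝ}
    (hf : Measurable f) {R β : ℝ}
    (h : (stdGaussian (EuclideanSpace ℂ J)).real {w | R < f w} ≤ β) :
    IsNoiseEvent μ ζ β {z | f (window J z) ≤ R} := by
  have hwindow : Measurable fun ω => window J fun t => ζ t ω :=
    (measurable_window J).comp hζ.measurable_path
  rw [← hζ.map_window J, map_measureReal_apply hwindow (measurableSet_lt measurable_const hf)] at h
  refine (isNoiseEvent_iff_compl hζ.measurable_path).2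
    ⟨measurableSet_le (hf.comp (measurable_window J)) measurable_const, ?_⟩
  simp only [Set.mem_ofPred_eq, not_le]
  exact h

theorem IsStdComplexGaussianNoise.isNoiseEvent_norm_window_convSeq
    (hζ : IsStdComplexGaussianNoise μ ζ) {u : ℤ → ℂ} {a b : ℤ} (hu : u ∈ seqSupportedOn a b)
    (T : Finset ℤ) {V β : ℝ} (hV : T.card * ∑ τ ∈ Finset.Icc a b, ‖u τ‖ ^ 2 ≤ V) (hβ : 0 < β) :
    IsNoiseEvent μ ζ β
      {z | ‖window T (convSeq u z)‖ ^ 2 ≤ 4 * V * (1 + Real.log (1 / β))} := by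
  let J := T.biUnion fun t => Finset.Icc (t - b) (t - a)
  have hJ (t) (ht : t ∈ T) : Finset.Icc (t - b) (t - a) ⊆ J :=
    Finset.subset_biUnion_of_mem (fun t => Finset.Icc (t - b) (t - a)) ht
  simp only [← toeplitzSection_window hu hJ]
  exact hζ.isNoiseEvent_of_stdGaussian
    (f := fun w => ‖toeplitzSection u J T w‖ ^ 2) (by fun_prop)
    (stdGaussian_norm_sq_apply_tail_hilbertSchmidt (toeplitzSection u J T)
      ((sum_norm_sq_toeplitzSection_basisFun_le hu J T).trans hV) hβ)

theorem IsStdComplexGaussianNoise.isNoiseEvent_norm_starProjection_window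
    (hζ : IsStdComplexGaussianNoise μ ζ) (T : Finset ℤ) (K : Submodule ℂ (EuclideanSpace ℂ T))
    {β : ℝ} (hβ : 0 < β) :
    IsNoiseEvent μ ζ β {z | ‖K.starProjection (window T z)‖ ^ 2
      ≤ 4 * (Module.finrank ℂ K + Real.log (1 / β))} := by
  have hHS := sum_norm_sq_starProjection_apply_orthonormalBasis_le
    (EuclideanSpace.basisFun T ℂ) ContinuousLinearMap.norm_id_le K
  refine hζ.isNoiseEvent_of_stdGaussian (f := fun w => ‖K.starProjection w‖ ^ 2) (by fun_prop) ?_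
  refine (measureReal_mono fun w hw => ?_).trans
    (stdGaussian_norm_sq_apply_tail _ one_pos K.starProjection_norm_le hHS hβ)
  rw [Set.mem_ofPred_eq, one_pow, one_mul]
  exact le_of_lt hw

theorem IsStdComplexGaussianNoise.isNoiseEvent_sum_norm_inner_window
    (hζ : IsStdComplexGaussianNoise μ ζ) {T : Finset ℤ} {κ : Type*} {I : Finset κ}
    {e : κ → EuclideanSpace ℂ T} {V β : ℝ} (hV : ∑ k ∈ I, ‖e k‖ ^ 2 ≤ V) (hβ : 0 < β) :
    IsNoiseEvent μ ζ β
      {z | ∑ k ∈ I, ‖inner ℂ (e k) (window T z)‖ ^ 2 ≤ 4 * V * (1 + Real.log (1 / β))} := by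
  let A : EuclideanSpace ℂ T →L[ℂ] EuclideanSpace ℂ I :=
    LinearMap.toContinuousLinearMap
      { toFun := fun w => WithLp.toLp 2 fun k => inner ℂ (e k) w
        map_add' := fun v w => by ext k; exact inner_add_right _ _ _
        map_smul' := fun c w => by ext k; exact inner_smul_right _ _ _ }
  have hA (w) : ‖A w‖ ^ 2 = ∑ k ∈ I, ‖inner ℂ (e k) w‖ ^ 2 :=
    (EuclideanSpace.norm_sq_eq _).trans (Finset.sum_coe_sort I fun k => ‖inner ℂ (e k) w‖ ^ 2)
  have hHS : ∑ j, ‖A (EuclideanSpace.basisFun T ℂ j)‖ ^ 2 ≤ V := by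
    refine le_of_eq_of_le ?_ hV
    simp only [hA]
    rw [Finset.sum_comm]
    exact Finset.sum_congr rfl fun k _ => (EuclideanSpace.basisFun T ℂ).sum_sq_norm_inner_left _
  simp only [← hA]
  exact hζ.isNoiseEvent_of_stdGaussian (f := fun w => ‖A w‖ ^ 2) (by fun_prop)
    (stdGaussian_norm_sq_apply_tail_hilbertSchmidt A hHS hβ)

theorem IsStdComplexGaussianNoise.isNoiseEvent_norm_inner_orthogonal_window_convSeq
    (hζ : IsStdComplexGaussianNoise μ ζ) {u : ℤ → ℂ} {a b : ℤ} (hu : u ∈ seqSupportedOn a b)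
    {T : Finset ℤ} (K : Submodule ℂ (EuclideanSpace ℂ T)) {V β : ℝ} (hV₀ : 0 < V)
    (hV : T.card * ∑ τ ∈ Finset.Icc a b, ‖u τ‖ ^ 2 ≤ V) (hβ : 0 < β) :
    IsNoiseEvent μ ζ (4 * β)
      {z | ‖inner ℂ (Kᗮ.starProjection (window T z)) (window T (convSeq u z))‖
        ≤ 4 * (T.card * ‖u 0‖ + √(Module.finrank ℂ K) * √V)
          + 8 * √V * (1 + Real.log (1 / β))} := by
  let J := T ∪ T.biUnion fun t => Finset.Icc (t - b) (t - a)
  have hTJ : T ⊆ J := Finset.subset_union_left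
  have hJ (t) (ht : t ∈ T) : Finset.Icc (t - b) (t - a) ⊆ J :=
    (Finset.subset_biUnion_of_mem (fun t => Finset.Icc (t - b) (t - a)) ht).trans
      Finset.subset_union_right
  have hHS := (sum_norm_sq_toeplitzSection_basisFun_le hu J T).trans hV
  have htrace := norm_sum_inner_orthogonal_starProjection_le (EuclideanSpace.basisFun J ℂ)
    (B := toeplitzSection u J T) (norm_restrictWindow_le hTJ) K
  rw [sum_inner_restrictWindow_toeplitzSection, norm_mul, Complex.norm_natCast] at htrace
  have hcontraction : ‖Kᗮ.starProjection ∘L restrictWindow hTJ‖ ≤ 1 :=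
    (ContinuousLinearMap.opNorm_comp_le _ _).trans
      (mul_le_one₀ Kᗮ.starProjection_norm_le (norm_nonneg _) (norm_restrictWindow_le hTJ))
  simp only [← toeplitzSection_window hu hJ, ← restrictWindow_window hTJ]
  exact hζ.isNoiseEvent_of_stdGaussian
    (f := fun w => ‖inner ℂ (Kᗮ.starProjection (restrictWindow hTJ w)) (toeplitzSection u J T w)‖)
    (by fun_prop)
    (stdGaussian_norm_inner_apply_tail _ _ hV₀ hcontraction hHS
      (htrace.trans (by gcongr)) hβ)

end Noise

/-! ### The discrete Fourier transform -/

/-- The `k`-th mode of the unitary discrete Fourier transform of length `n + 1`, as a sequence on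
all of `ℤ`. -/
noncomputable def fourierMode (n k : ℕ) (t : ℤ) : ℂ :=
  ((√((n : ℝ) + 1))⁻¹ : ℝ) * Complex.exp (2 * Real.pi * Complex.I * k * t / (n + 1))

/-- The filter on `[H, n + H]` whose shift back to `[0, n]` has the `k`-th unit vector as its
discrete Fourier transform. -/
noncomputable def harmonicFilter (n : ℕ) (H : ℤ) (k : ℕ) : ℤ → ℂ := fun τ =>
  if τ ∈ Set.Icc H (n + H) then starRingEnd ℂ (fourierMode n k (τ - H)) else 0

theorem dftCoeff_eq_sum_fourierMode (n : ℕ) (u : ℤ → ℂ) (k : ℕ) :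
    dftCoeff n u k = ∑ t ∈ Finset.Icc (0 : ℤ) n, u t * fourierMode n k t := by
  rw [← sum_range_eq_sum_Icc fun t => u t * fourierMode n k t, dftCoeff, Finset.mul_sum]
  simp only [fourierMode, Int.cast_natCast, mul_left_comm]

theorem fourierMode_add (n k : ℕ) (s t : ℤ) :
    fourierMode n k (s + t) = √((n : ℝ) + 1) * (fourierMode n k s * fourierMode n k t) := by
  have hsqrt : (√((n : ℝ) + 1) : ℂ) ≠ 0 := by
    exact_mod_cast (Real.sqrt_pos.2 (by positivity)).ne'
  have hexp : 2 * Real.pi * Complex.I * k * ((s + t : ℤ) : ℂ) / (n + 1)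
      = 2 * Real.pi * Complex.I * k * s / (n + 1)
        + 2 * Real.pi * Complex.I * k * t / (n + 1) := by
    push_cast
    ring
  simp only [fourierMode]
  rw [hexp, Complex.exp_add]
  push_cast
  field_simp

theorem conj_fourierMode (n k : ℕ) (t : ℤ) :
    starRingEnd ℂ (fourierMode n k t) = fourierMode n k (-t) := by
  rw [fourierMode, fourierMode, map_mul, Complex.conj_ofReal, ← Complex.exp_conj]
  congr 2
  simp only [map_div₀, map_mul, map_add, map_one, map_ofNat, map_natCast, map_intCast,
    Complex.conj_ofReal, Complex.conj_I]
  push_cast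
  ring

theorem norm_fourierMode (n k : ℕ) (t : ℤ) : ‖fourierMode n k t‖ = (√((n : ℝ) + 1))⁻¹ := by
  have hphase : 2 * Real.pi * Complex.I * k * t / (n + 1)
      = ((2 * Real.pi * k * t / (n + 1) : ℝ) : ℂ) * Complex.I := by
    push_cast
    ring
  rw [fourierMode, hphase, norm_mul, Complex.norm_exp_ofReal_mul_I, mul_one,
    Complex.norm_of_nonneg (by positivity)]

theorem sum_exp_eq_ite (n : ℕ) {d : ℤ} (hd : |d| ≤ n) :
    ∑ k ∈ Finset.range (n + 1), Complex.exp (2 * Real.pi * Complex.I * k * d / (n + 1))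
      = if d = 0 then (n : ℂ) + 1 else 0 := by
  have hn : (n : ℂ) + 1 ≠ 0 := by exact_mod_cast Nat.succ_ne_zero n
  split_ifs with hd₀
  · simp [hd₀]
  let w := Complex.exp (2 * Real.pi * Complex.I * d / (n + 1))
  have hpow (k : ℕ) : Complex.exp (2 * Real.pi * Complex.I * k * d / (n + 1)) = w ^ k := by
    rw [← Complex.exp_nat_mul]
    congr 1
    ring
  have hw_ne_one : w ≠ 1 := by
    rw [Ne, Complex.exp_eq_one_iff]
    rintro ⟨l, hl⟩
    have hdl : d = (n + 1) * l := by
      field_simp at hl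
      exact_mod_cast hl
    exact hd₀ (Int.eq_zero_of_abs_lt_dvd ⟨l, hdl⟩ (by omega))
  have hw_root : w ^ (n + 1) = 1 := by
    rw [← Complex.exp_nat_mul, Complex.exp_eq_one_iff]
    refine ⟨d, ?_⟩
    push_cast
    field_simp
  simp only [hpow]
  rw [geom_sum_eq hw_ne_one, hw_root, sub_self, zero_div]

theorem sum_fourierMode_mul_conj (n : ℕ) {s t : ℤ} (hst : |s - t| ≤ n) :
    ∑ k ∈ Finset.range (n + 1), fourierMode n k s * starRingEnd ℂ (fourierMode n k t)
      = if s = t then 1 else 0 := by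
  have hn : (n : ℂ) + 1 ≠ 0 := by exact_mod_cast Nat.succ_ne_zero n
  have hsqrt : (√((n : ℝ) + 1) : ℂ)⁻¹ * (√((n : ℝ) + 1) : ℂ)⁻¹ = ((n : ℂ) + 1)⁻¹ := by
    rw [← mul_inv, ← Complex.ofReal_mul, Real.mul_self_sqrt (by positivity)]
    push_cast
    rfl
  have hterm (k : ℕ) : fourierMode n k s * starRingEnd ℂ (fourierMode n k t)
      = ((n : ℂ) + 1)⁻¹ * Complex.exp (2 * Real.pi * Complex.I * k * (s - t : ℤ) / (n + 1)) := by
    rw [conj_fourierMode, fourierMode, fourierMode, mul_mul_mul_comm, Complex.ofReal_inv, hsqrt,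
      ← Complex.exp_add]
    congr 2
    push_cast
    ring
  simp only [hterm]
  rw [← Finset.mul_sum, sum_exp_eq_ite n hst]
  simp only [sub_eq_zero, mul_ite, mul_zero, inv_mul_cancel₀ hn]

theorem sum_dftCoeff_mul_conj_fourierMode (n : ℕ) (u : ℤ → ℂ) {s : ℤ}
    (hs : s ∈ Finset.Icc (0 : ℤ) n) :
    ∑ k ∈ Finset.range (n + 1), dftCoeff n u k * starRingEnd ℂ (fourierMode n k s) = u s := by
  simp only [dftCoeff_eq_sum_fourierMode, Finset.sum_mul, mul_assoc]
  rw [Finset.sum_comm]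
  have horth (t) (ht : t ∈ Finset.Icc (0 : ℤ) n) : ∑ k ∈ Finset.range (n + 1),
      u t * (fourierMode n k t * starRingEnd ℂ (fourierMode n k s)) = if t = s then u t else 0 := by
    rw [Finset.mem_Icc] at hs ht
    rw [← Finset.mul_sum, sum_fourierMode_mul_conj n (abs_le.2 ⟨by omega, by omega⟩), mul_ite,
      mul_one, mul_zero]
  rw [Finset.sum_congr rfl horth, Finset.sum_ite_eq', if_pos hs]

theorem sum_norm_sq_dftCoeff (n : ℕ) (u : ℤ → ℂ) :
    ∑ k ∈ Finset.range (n + 1), ‖dftCoeff n u k‖ ^ 2 = ∑ t ∈ Finset.Icc (0 : ℤ) n, ‖u t‖ ^ 2 := by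
  have hparseval : ∑ k ∈ Finset.range (n + 1), dftCoeff n u k * starRingEnd ℂ (dftCoeff n u k)
      = ∑ t ∈ Finset.Icc (0 : ℤ) n, u t * starRingEnd ℂ (u t) := by
    have hconj (k : ℕ) : starRingEnd ℂ (dftCoeff n u k) = ∑ t ∈ Finset.Icc (0 : ℤ) n,
        starRingEnd ℂ (fourierMode n k t) * starRingEnd ℂ (u t) := by
      simp only [dftCoeff_eq_sum_fourierMode, map_sum, map_mul, mul_comm]
    simp only [hconj, Finset.mul_sum, ← mul_assoc]
    rw [Finset.sum_comm]
    simp only [← Finset.sum_mul]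
    exact Finset.sum_congr rfl fun t ht => by rw [sum_dftCoeff_mul_conj_fourierMode n u ht]
  simp only [Complex.mul_conj, Complex.normSq_eq_norm_sq] at hparseval
  exact_mod_cast hparseval

theorem dftCoeff_eq_convSeq {n : ℕ} {u : ℤ → ℂ} (hu : u ∈ seqSupportedOn 0 n) (k : ℕ) :
    dftCoeff n u k = convSeq u (fun t => fourierMode n k (-t)) 0 := by
  rw [dftCoeff_eq_sum_fourierMode, convSeq_eq_sum hu subset_rfl]
  simp only [zero_sub, neg_neg]

theorem convSeq_fourierMode_neg {n : ℕ} {u : ℤ → ℂ} (hu : u ∈ seqSupportedOn 0 n) (k : ℕ) :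
    convSeq u (fun t => fourierMode n k (-t))
      = (√((n : ℝ) + 1) * dftCoeff n u k : ℂ) • fun t => fourierMode n k (-t) := by
  funext t
  rw [convSeq_eq_sum hu subset_rfl, Pi.smul_apply, smul_eq_mul, dftCoeff_eq_sum_fourierMode,
    Finset.mul_sum, Finset.sum_mul]
  refine Finset.sum_congr rfl fun τ _ => ?_
  rw [neg_sub, sub_eq_add_neg, fourierMode_add]
  ring

theorem dftCoeff_convSeq {n m m' : ℕ} (hn : m + m' ≤ n) {u v : ℤ → ℂ}
    (hu : u ∈ seqSupportedOn 0 m) (hv : v ∈ seqSupportedOn 0 m') (k : ℕ) :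
    dftCoeff n (convSeq u v) k = √((n : ℝ) + 1) * (dftCoeff n u k * dftCoeff n v k) := by
  have huv : convSeq u v ∈ seqSupportedOn 0 n :=
    seqSupportedOn_mono (by omega) (by omega) (convSeq_mem_seqSupportedOn hu hv)
  have hu' : u ∈ seqSupportedOn 0 (n : ℤ) := seqSupportedOn_mono le_rfl (by omega) hu
  have hv' : v ∈ seqSupportedOn 0 (n : ℤ) := seqSupportedOn_mono le_rfl (by omega) hv
  rw [dftCoeff_eq_convSeq huv, convSeq_assoc hu hv, convSeq_fourierMode_neg hv',
    (isLinearMap_convSeq hu).map_smul, Pi.smul_apply, smul_eq_mul, ← dftCoeff_eq_convSeq hu']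
  ring

theorem dftNormOne_convSeq_self {n m : ℕ} (hn : 2 * m ≤ n) {u : ℤ → ℂ}
    (hu : u ∈ seqSupportedOn 0 m) :
    dftNormOne n (convSeq u u) = √((n : ℝ) + 1) * ∑ t ∈ Finset.Icc (0 : ℤ) n, ‖u t‖ ^ 2 := by
  rw [← sum_norm_sq_dftCoeff, Finset.mul_sum]
  refine Finset.sum_congr rfl fun k _ => ?_
  rw [dftCoeff_convSeq (by omega) hu hu, norm_mul, norm_mul,
    Complex.norm_of_nonneg (Real.sqrt_nonneg _), sq]

theorem dftNormOne_sub_le (n : ℕ) (u v : ℤ → ℂ) :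
    dftNormOne n (u - v) ≤ dftNormOne n u + dftNormOne n v := by
  have hsub (k : ℕ) : dftCoeff n (u - v) k = dftCoeff n u k - dftCoeff n v k := by
    simp only [dftCoeff_eq_sum_fourierMode, Pi.sub_apply, sub_mul, Finset.sum_sub_distrib]
  simp only [dftNormOne, hsub, ← Finset.sum_add_distrib]
  exact Finset.sum_le_sum fun k _ => norm_sub_le _ _

theorem sum_norm_sq_le_dftNormOne_shiftSeq_sq (n : ℕ) (H : ℤ) (u : ℤ → ℂ) :
    ∑ t ∈ Finset.Icc H (n + H), ‖u t‖ ^ 2 ≤ dftNormOne n (shiftSeq (-H) u) ^ 2 := by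
  rw [← norm_window_sq, ← windowNorm_shiftSeq, windowNorm, Real.sq_sqrt (by positivity),
    sum_range_eq_sum_Icc fun t => ‖shiftSeq (-H) u t‖ ^ 2, ← sum_norm_sq_dftCoeff]
  exact Finset.sum_sq_le_sq_sum_of_nonneg fun _ _ => norm_nonneg _

/-! ### Harmonic filters -/

theorem harmonicFilter_mem_seqSupportedOn (n : ℕ) (H : ℤ) (k : ℕ) :
    harmonicFilter n H k ∈ seqSupportedOn H (n + H) := fun _ ht => if_neg ht

theorem norm_harmonicFilter_sq_le (n : ℕ) (H : ℤ) (k : ℕ) (τ : ℤ) :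
    ‖harmonicFilter n H k τ‖ ^ 2 ≤ ((n : ℝ) + 1)⁻¹ := by
  rw [harmonicFilter]
  split_ifs
  · rw [RCLike.norm_conj, norm_fourierMode, inv_pow, Real.sq_sqrt (by positivity)]
  · rw [norm_zero, zero_pow two_ne_zero]
    positivity

theorem sum_norm_harmonicFilter_sq_le (n : ℕ) (H : ℤ) (k : ℕ) :
    ∑ τ ∈ Finset.Icc H (n + H), ‖harmonicFilter n H k τ‖ ^ 2 ≤ 1 := by
  refine (Finset.sum_le_card_nsmul _ _ _ fun τ _ => norm_harmonicFilter_sq_le n H k τ).trans_eq ?_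
  rw [nsmul_eq_mul, card_Icc_add, mul_inv_cancel₀ (by positivity)]

theorem convSeq_harmonicFilter_apply (n : ℕ) (H : ℤ) (k : ℕ) (v : ℤ → ℂ) (t : ℤ) :
    convSeq (harmonicFilter n H k) v t
      = ∑ τ ∈ Finset.Icc (0 : ℤ) n, starRingEnd ℂ (fourierMode n k τ) * v (t - H - τ) := by
  have hshift := sum_Icc_shift
    (fun τ => starRingEnd ℂ (fourierMode n k τ) * v (t - H - τ)) H (n + H) H
  simp only [sub_self, add_sub_cancel_right, sub_sub, add_sub_cancel] at hshift
  rw [convSeq_eq_sum (harmonicFilter_mem_seqSupportedOn n H k) subset_rfl]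
  simp only [sub_sub, ← hshift]
  refine Finset.sum_congr rfl fun τ hτ => ?_
  rw [harmonicFilter, if_pos (Set.mem_Icc.2 (Finset.mem_Icc.1 hτ))]

theorem convSeq_eq_sum_dftCoeff_smul {n : ℕ} {H : ℤ} {u : ℤ → ℂ}
    (hu : u ∈ seqSupportedOn H (n + H)) (v : ℤ → ℂ) :
    convSeq u v = ∑ k ∈ Finset.range (n + 1),
      dftCoeff n (shiftSeq (-H) u) k • convSeq (harmonicFilter n H k) v := by
  funext t
  have hshift := sum_Icc_shift (fun τ => shiftSeq (-H) u τ * v (t - H - τ)) H (n + H) H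
  simp only [sub_self, add_sub_cancel_right, shiftSeq, sub_neg_eq_add, sub_add_cancel, sub_sub,
    add_sub_cancel] at hshift
  rw [convSeq_eq_sum hu subset_rfl, hshift]
  simp only [Finset.sum_apply, Pi.smul_apply, smul_eq_mul, convSeq_harmonicFilter_apply,
    Finset.mul_sum, ← mul_assoc, sub_sub]
  rw [Finset.sum_comm]
  simp only [← Finset.sum_mul]
  refine Finset.sum_congr rfl fun τ hτ => ?_
  rw [sum_dftCoeff_mul_conj_fourierMode n _ hτ, shiftSeq, sub_neg_eq_add]

theorem sum_norm_sq_convSeq_harmonicFilter (n : ℕ) (H : ℤ) (v : ℤ → ℂ) (t : ℤ) :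
    ∑ k ∈ Finset.range (n + 1), ‖convSeq (harmonicFilter n H k) v t‖ ^ 2
      = ∑ τ ∈ Finset.Icc (t - H - n) (t - H), ‖v τ‖ ^ 2 := by
  have hreflect := sum_Icc_reflect (fun τ => ‖v τ‖ ^ 2) 0 n (t - H)
  rw [sub_zero] at hreflect
  have hconj (k : ℕ) : convSeq (harmonicFilter n H k) v t
      = starRingEnd ℂ (dftCoeff n (fun τ => starRingEnd ℂ (v (t - H - τ))) k) := by
    simp only [convSeq_harmonicFilter_apply, dftCoeff_eq_sum_fourierMode, map_sum, map_mul,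
      RCLike.conj_conj, mul_comm]
  simp only [hconj, RCLike.norm_conj, sum_norm_sq_dftCoeff, hreflect]

theorem norm_sum_dftCoeff_mul_le (n : ℕ) (u : ℤ → ℂ) {c : ℕ → ℂ} {R : ℝ}
    (hc : ∀ k ∈ Finset.range (n + 1), ‖c k‖ ≤ R) :
    ‖∑ k ∈ Finset.range (n + 1), dftCoeff n u k * c k‖ ≤ dftNormOne n u * R := by
  rw [dftNormOne, Finset.sum_mul]
  refine norm_sum_le_of_le _ fun k hk => ?_
  rw [norm_mul]
  exact mul_le_mul_of_nonneg_left (hc k hk) (norm_nonneg _)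

theorem norm_convSeq_le_dftNormOne_mul {n : ℕ} {H : ℤ} {u : ℤ → ℂ}
    (hu : u ∈ seqSupportedOn H (n + H)) {v : ℤ → ℂ} {t : ℤ} {R : ℝ}
    (hR : ∀ k ∈ Finset.range (n + 1), ‖convSeq (harmonicFilter n H k) v t‖ ≤ R) :
    ‖convSeq u v t‖ ≤ dftNormOne n (shiftSeq (-H) u) * R := by
  rw [convSeq_eq_sum_dftCoeff_smul hu, Finset.sum_apply]
  exact norm_sum_dftCoeff_mul_le n _ hR

theorem norm_inner_window_convSeq_le_dftNormOne_mul {n : ℕ} {H : ℤ} {u : ℤ → ℂ}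
    (hu : u ∈ seqSupportedOn H (n + H)) {v : ℤ → ℂ} {T : Finset ℤ} {w : EuclideanSpace ℂ T}
    {R : ℝ} (hR : ∀ k ∈ Finset.range (n + 1),
      ‖inner ℂ w (window T (convSeq (harmonicFilter n H k) v))‖ ≤ R) :
    ‖inner ℂ w (window T (convSeq u v))‖ ≤ dftNormOne n (shiftSeq (-H) u) * R := by
  rw [convSeq_eq_sum_dftCoeff_smul hu, map_sum, inner_sum]
  simp only [map_smul, inner_smul_right]
  exact norm_sum_dftCoeff_mul_le n _ hR

/-! ### The oracle filter -/

section MeanSquareError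

theorem integral_norm_sq_apply_stdGaussian {E F ι : Type*} [NormedAddCommGroup E]
    [InnerProductSpace ℝ E] [FiniteDimensional ℝ E] [MeasurableSpace E] [BorelSpace E]
    [NormedAddCommGroup F] [InnerProductSpace ℝ F] [FiniteDimensional ℝ F] [Fintype ι]
    (b : OrthonormalBasis ι ℝ E) (A : E →L[ℝ] F) :
    ∫ w, ‖A w‖ ^ 2 ∂stdGaussian E = ∑ i, ‖A (b i)‖ ^ 2 := by
  let c := stdOrthonormalBasis ℝ F
  let L (j : Fin (Module.finrank ℝ F)) : StrongDual ℝ E := innerSL ℝ (A.adjoint (c j))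
  have hL (j w) : L j w = inner ℝ (c j) (A w) := A.adjoint_inner_left w (c j)
  have hL2 (j) : MemLp (L j) 2 (stdGaussian E) :=
    (IsGaussian.memLp_two_id (μ := stdGaussian E)).continuousLinearMap_comp (L j)
  have hsecond (j) : ∫ w, L j w ^ 2 ∂stdGaussian E = ‖A.adjoint (c j)‖ ^ 2 := by
    rw [← variance_of_integral_eq_zero (hL2 j).aestronglyMeasurable.aemeasurable
      (integral_strongDual_stdGaussian (L j)), variance_dual_stdGaussian, innerSL_apply_norm]
  have hnorm (w : E) : ‖A w‖ ^ 2 = ∑ j, L j w ^ 2 := by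
    simp only [hL, ← c.sum_sq_norm_inner_right (A w), Real.norm_eq_abs, sq_abs]
  simp only [hnorm]
  rw [integral_finsetSum _ fun j _ => (hL2 j).integrable_sq]
  simp only [hsecond, ← hnorm, sum_norm_sq_adjoint_apply_orthonormalBasis b c A]

theorem integral_norm_sub_apply_sq_stdGaussian {E F ι : Type*} [NormedAddCommGroup E]
    [InnerProductSpace ℝ E] [FiniteDimensional ℝ E] [MeasurableSpace E] [BorelSpace E]
    [NormedAddCommGroup F] [InnerProductSpace ℝ F] [FiniteDimensional ℝ F] [Fintype ι]
    (b : OrthonormalBasis ι ℝ E) (A : E →L[ℝ] F) (a : F) :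
    ∫ w, ‖a - A w‖ ^ 2 ∂stdGaussian E = ‖a‖ ^ 2 + ∑ i, ‖A (b i)‖ ^ 2 := by
  let L : StrongDual ℝ E := innerSL ℝ a ∘L A
  have hA2 : MemLp A 2 (stdGaussian E) :=
    (IsGaussian.memLp_two_id (μ := stdGaussian E)).continuousLinearMap_comp A
  have hL : Integrable L (stdGaussian E) :=
    L.integrable_comp (IsGaussian.integrable_id (μ := stdGaussian E))
  have hexpand (w : E) : ‖a - A w‖ ^ 2 = ‖a‖ ^ 2 - 2 * L w + ‖A w‖ ^ 2 := norm_sub_sq_real a (A w)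
  simp only [hexpand]
  have hcross : Integrable (fun w => ‖a‖ ^ 2 - 2 * L w) (stdGaussian E) :=
    (integrable_const _).sub (hL.const_mul 2)
  rw [integral_add hcross hA2.norm.integrable_sq,
    integral_sub (integrable_const _) (hL.const_mul 2), integral_const_mul,
    integral_strongDual_stdGaussian, integral_norm_sq_apply_stdGaussian b]
  simp

theorem IsStdComplexGaussianNoise.integral_norm_sub_convSeq_sq {Ω : Type*} [MeasurableSpace Ω]
    {μ : Measure Ω} {ζ : ℤ → Ω → ℂ} (hζ : IsStdComplexGaussianNoise μ ζ)
    {φ : ℤ → ℂ} {a b : ℤ} (hφ : φ ∈ seqSupportedOn a b) (d : ℂ) (t : ℤ) :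
    ∫ ω, ‖d - convSeq φ (fun τ => ζ τ ω) t‖ ^ 2 ∂μ
      = ‖d‖ ^ 2 + 2 * ∑ τ ∈ Finset.Icc a b, ‖φ τ‖ ^ 2 := by
  let J := Finset.Icc (t - b) (t - a)
  let A : EuclideanSpace ℂ J →L[ℂ] ℂ := EuclideanSpace.proj ⟨t, Finset.mem_singleton_self t⟩ ∘L
    toeplitzSection φ J {t}
  have hA (z : ℤ → ℂ) : A (window J z) = convSeq φ z t := by
    have hJ : ∀ τ ∈ ({t} : Finset ℤ), Finset.Icc (τ - b) (τ - a) ⊆ J := by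
      rintro τ hτ
      rw [Finset.mem_singleton.1 hτ]
    exact congrArg (fun w : EuclideanSpace ℂ ({t} : Finset ℤ) => w ⟨t, Finset.mem_singleton_self t⟩)
      (toeplitzSection_window hφ hJ z)
  have hnorm : ∑ j, ‖A (EuclideanSpace.basisFun J ℂ j)‖ ^ 2 = ∑ τ ∈ Finset.Icc a b, ‖φ τ‖ ^ 2 := by
    have hentry (j : J) : A (EuclideanSpace.basisFun J ℂ j) = φ (t - j) :=
      toeplitzSection_basisFun φ J {t} j _
    have hreflect := sum_Icc_reflect (fun τ => ‖φ τ‖ ^ 2) (t - b) (t - a) t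
    simp only [sub_sub_cancel] at hreflect
    simp only [hentry, ← hreflect]
    exact Finset.sum_coe_sort J fun τ => ‖φ (t - τ)‖ ^ 2
  rw [← hnorm, ← sum_norm_sq_apply_realBasis]
  refine Eq.trans ?_ (integral_norm_sub_apply_sq_stdGaussian (realBasis J)
    (A.restrictScalars ℝ) d)
  have hwindow : Measurable fun ω => window J fun t => ζ t ω :=
    (measurable_window J).comp hζ.measurable_path
  rw [← hζ.map_window J, integral_map hwindow.aemeasurable
    (Continuous.aestronglyMeasurable (by fun_prop))]
  simp only [ContinuousLinearMap.coe_restrictScalars', hA]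

end MeanSquareError

/-- A filter on `[h, m + h]` whose energy and whose bias on `[-m + h, n + h]` are as small as
predictability allows. It is compared with the least-squares estimator through its square
`q * q`. -/
structure IsOracleFilter (m n h : ℕ) (ρ σ : ℝ) (x q : ℤ → ℂ) : Prop where
  mem_seqSupportedOn : q ∈ seqSupportedOn (h : ℤ) (m + h)
  energy_le : ∑ τ ∈ Finset.Icc (h : ℤ) (m + h), ‖q τ‖ ^ 2 ≤ ρ / (2 * (m + 1))
  bias_le : ∀ t : ℤ, -(m : ℤ) + h ≤ t → t ≤ n + h →
    ‖(x - convSeq q x) t‖ ^ 2 ≤ ρ * σ ^ 2 / (m + 1)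

theorem observedSeq_eq_add_smul (x : ℤ → ℂ) (σ : ℝ) (z : ℤ → ℂ) :
    observedSeq x σ z = x + (σ : ℂ) • z := rfl

theorem convSeq_observedSeq {u : ℤ → ℂ} {a b : ℤ} (hu : u ∈ seqSupportedOn a b) (x : ℤ → ℂ)
    (σ : ℝ) (z : ℤ → ℂ) :
    convSeq u (observedSeq x σ z) = convSeq u x + (σ : ℂ) • convSeq u z := by
  rw [observedSeq_eq_add_smul, (isLinearMap_convSeq hu).map_add, (isLinearMap_convSeq hu).map_smul]

theorem IsStdComplexGaussianNoise.integral_norm_sub_convSeq_observedSeq_sq {Ω : Type*}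
    [MeasurableSpace Ω] {μ : Measure Ω} {ζ : ℤ → Ω → ℂ}
    (hζ : IsStdComplexGaussianNoise μ ζ) {φ : ℤ → ℂ} {a b : ℤ} (hφ : φ ∈ seqSupportedOn a b)
    (x : ℤ → ℂ) (σ : ℝ) (t : ℤ) :
    ∫ ω, ‖x t - convSeq φ (observedSeq x σ fun τ => ζ τ ω) t‖ ^ 2 ∂μ
      = ‖(x - convSeq φ x) t‖ ^ 2 + 2 * σ ^ 2 * ∑ τ ∈ Finset.Icc a b, ‖φ τ‖ ^ 2 := by
  have hσφ : (σ : ℂ) • φ ∈ seqSupportedOn a b := fun τ hτ => by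
    rw [Pi.smul_apply, hφ τ hτ, smul_zero]
  have hscale (z : ℤ → ℂ) : ((σ : ℂ) • convSeq φ z) t = convSeq ((σ : ℂ) • φ) z t := by
    simp only [Pi.smul_apply, smul_eq_mul, convSeq_eq_sum hφ subset_rfl,
      convSeq_eq_sum hσφ subset_rfl, Finset.mul_sum, mul_assoc]
  simp only [convSeq_observedSeq hφ, Pi.add_apply, hscale, ← sub_sub]
  rw [hζ.integral_norm_sub_convSeq_sq hσφ]
  simp only [Pi.smul_apply, Pi.sub_apply, norm_smul, Complex.norm_real, mul_pow,
    Real.norm_eq_abs, sq_abs, ← Finset.mul_sum, mul_assoc]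

theorem IsPredictableSignal.exists_isOracleFilter {Ω : Type*} [MeasurableSpace Ω] {μ : Measure Ω}
    {ζ : ℤ → Ω → ℂ} (hζ : IsStdComplexGaussianNoise μ ζ) {σ : ℝ} (hσ : 0 < σ)
    {m n h : ℕ} {ρ : ℝ} {x : ℤ → ℂ} (hx : IsPredictableSignal μ ζ σ m n h ρ x) :
    ∃ q, IsOracleFilter m n h ρ σ x q := by
  obtain ⟨q, hq, hmse⟩ := hx
  simp only [hζ.integral_norm_sub_convSeq_observedSeq_sq hq] at hmse
  refine ⟨q, hq, ?_, fun t ht₁ ht₂ => (le_add_of_nonneg_right ?_).trans (hmse t ht₁ ht₂)⟩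
  · have henergy : 2 * σ ^ 2 * ∑ τ ∈ Finset.Icc (h : ℤ) (m + h), ‖q τ‖ ^ 2
        ≤ ρ * σ ^ 2 / (m + 1) :=
      (le_add_of_nonneg_left (sq_nonneg _)).trans (hmse h (by omega) (by omega))
    refine le_of_mul_le_mul_left (henergy.trans_eq ?_) (by positivity : 0 < 2 * σ ^ 2)
    field_simp
  · positivity

theorem norm_sum_sq_le_card_mul {ι E : Type*} [SeminormedAddCommGroup E] (s : Finset ι)
    (f : ι → E) : ‖∑ i ∈ s, f i‖ ^ 2 ≤ s.card * ∑ i ∈ s, ‖f i‖ ^ 2 :=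
  (pow_le_pow_left₀ (norm_nonneg _) (norm_sum_le s f) 2).trans sq_sum_le_card_mul_sum_sq

theorem norm_add_sq_le_two_mul {E : Type*} [SeminormedAddCommGroup E] (a b : E) :
    ‖a + b‖ ^ 2 ≤ 2 * (‖a‖ ^ 2 + ‖b‖ ^ 2) := by
  simpa [Fin.sum_univ_two] using norm_sum_sq_le_card_mul Finset.univ ![a, b]

namespace IsOracleFilter

variable {m n N h : ℕ} {ρ σ : ℝ} {x q : ℤ → ℂ}

theorem sum_norm_bias_sq_le (hq : IsOracleFilter m N h ρ σ x q) {a b : ℤ} {k : ℕ}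
    (hab : b = k + a) (ha : -(m : ℤ) + h ≤ a) (hb : b ≤ N + h) :
    ∑ t ∈ Finset.Icc a b, ‖(x - convSeq q x) t‖ ^ 2 ≤ (k + 1) * (ρ * σ ^ 2 / (m + 1)) := by
  subst hab
  refine (Finset.sum_le_card_nsmul _ _ (ρ * σ ^ 2 / (m + 1)) fun t ht => ?_).trans_eq ?_
  · obtain ⟨hat, htb⟩ := Finset.mem_Icc.1 ht
    exact hq.bias_le t (by omega) (by omega)
  · rw [nsmul_eq_mul, card_Icc_add]

theorem convSeq_self_mem_predictFeasible (hq : IsOracleFilter m N h ρ σ x q) (hn : n = 2 * m) :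
    convSeq q q ∈ predictFeasible n (2 * h) ρ := by
  have hsupp := hq.mem_seqSupportedOn
  refine ⟨seqSupportedOn_mono (by omega) (by omega) (convSeq_mem_seqSupportedOn hsupp hsupp), ?_⟩
  have hshift : shiftSeq (-(h : ℤ)) q ∈ seqSupportedOn 0 m := by
    have hmem := shiftSeq_mem_seqSupportedOn hsupp (-h)
    rwa [add_neg_cancel, add_neg_cancel_right] at hmem
  have henergy : ∑ t ∈ Finset.Icc (0 : ℤ) n, ‖shiftSeq (-(h : ℤ)) q t‖ ^ 2 ≤ ρ / (n + 1) := by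
    refine (sum_norm_sq_le_sum_Icc_of_mem_seqSupportedOn hshift _).trans ?_
    have hreindex := sum_Icc_shift (fun t => ‖shiftSeq (-(h : ℤ)) q t‖ ^ 2) h (m + h) h
    simp only [shiftSeq, sub_neg_eq_add, sub_add_cancel, sub_self, add_sub_cancel_right]
      at hreindex ⊢
    have hρ : 0 ≤ ρ / (2 * (m + 1)) :=
      (Finset.sum_nonneg fun τ _ => sq_nonneg ‖q τ‖).trans hq.energy_le
    rw [le_div_iff₀ (by positivity), zero_mul] at hρ
    rw [← hreindex, hn]
    refine hq.energy_le.trans ?_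
    push_cast
    gcongr
    linarith
  have hdouble : -((2 * h : ℕ) : ℤ) = -h + -h := by omega
  rw [hdouble, ← convSeq_shiftSeq_shiftSeq, dftNormOne_convSeq_self hn.ge hshift]
  refine (mul_le_mul_of_nonneg_left henergy (Real.sqrt_nonneg _)).trans_eq ?_
  rw [mul_div_assoc', mul_comm, mul_div_assoc, Real.sqrt_div_self']
  ring

theorem norm_window_bias_convSeq_self_sq_le (hq : IsOracleFilter m (n + 2 * h) h ρ σ x q)
    (hn : n = 2 * m) (hρ : 1 ≤ ρ) :
    ‖window (Finset.Icc (2 * h : ℕ) (n + (2 * h : ℕ))) (x - convSeq (convSeq q q) x)‖ ^ 2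
      ≤ 6 * σ ^ 2 * ρ ^ 2 := by
  have hsupp := hq.mem_seqSupportedOn
  let g := x - convSeq q x
  have hsplit : x - convSeq (convSeq q q) x = g + convSeq q g := by
    rw [convSeq_assoc hsupp hsupp, (isLinearMap_convSeq hsupp).map_sub]
    simp only [g]
    abel
  have hmn : (n + 1 : ℝ) ≤ 2 * (m + 1) := by
    rw [hn]
    push_cast
    linarith
  have hbias : ‖window (Finset.Icc (2 * h : ℕ) (n + (2 * h : ℕ))) g‖ ^ 2 ≤ 2 * (ρ * σ ^ 2) := by
    rw [norm_window_sq]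
    refine (hq.sum_norm_bias_sq_le rfl (by omega) (by omega)).trans ?_
    rw [mul_div_assoc', div_le_iff₀ (by positivity)]
    have := mul_le_mul_of_nonneg_right hmn (by positivity : 0 ≤ ρ * σ ^ 2)
    linarith
  have hfiltered : ‖window (Finset.Icc (2 * h : ℕ) (n + (2 * h : ℕ))) (convSeq q g)‖ ^ 2
      ≤ ρ ^ 2 * σ ^ 2 := by
    have hpoint (t) (ht : t ∈ Finset.Icc ((2 * h : ℕ) : ℤ) (n + (2 * h : ℕ))) :
        ‖convSeq q g t‖ ^ 2 ≤ ρ ^ 2 * σ ^ 2 / (2 * (m + 1)) := by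
      rw [Finset.mem_Icc] at ht
      refine (norm_convSeq_sq_le hsupp g t).trans ((mul_le_mul hq.energy_le
        (hq.sum_norm_bias_sq_le (k := m) (by ring) (by omega) (by omega))
        (by positivity) (by positivity)).trans_eq ?_)
      field_simp
    rw [norm_window_sq]
    refine (Finset.sum_le_card_nsmul _ _ _ hpoint).trans ?_
    rw [nsmul_eq_mul, card_Icc_add, mul_div_assoc', div_le_iff₀ (by positivity), mul_comm]
    gcongr
  rw [hsplit, map_add]
  have hρσ : ρ * σ ^ 2 ≤ ρ ^ 2 * σ ^ 2 := by
    gcongr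
    exact le_self_pow₀ hρ two_ne_zero
  linarith [norm_add_sq_le_two_mul (window (Finset.Icc (2 * h : ℕ) (n + (2 * h : ℕ))) g)
    (window (Finset.Icc (2 * h : ℕ) (n + (2 * h : ℕ))) (convSeq q g))]

end IsOracleFilter

/-! ### The least-squares estimator -/

theorem norm_sq_le_of_norm_add_sq_le {W : Type*} [NormedAddCommGroup W] [InnerProductSpace ℂ W]
    (K : Submodule ℂ W) [K.HasOrthogonalProjection] {v v₀ w : W} {B : ℝ}
    (h : ‖v + w‖ ^ 2 ≤ ‖v₀ + w‖ ^ 2) (hB : ‖inner ℂ (Kᗮ.starProjection w) (v₀ - v)‖ ≤ B) :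
    ‖v‖ ^ 2 ≤ 4 * ‖v₀‖ ^ 2 + 6 * ‖K.starProjection w‖ ^ 2 + 4 * B := by
  let p := ‖K.starProjection w‖
  have hbasic : ‖v‖ ^ 2 ≤ ‖v₀‖ ^ 2 + 2 * (inner ℂ w (v₀ - v)).re := by
    rw [add_comm v, add_comm v₀, norm_add_sq (𝕜 := ℂ), norm_add_sq (𝕜 := ℂ)] at h
    rw [inner_sub_right, Complex.sub_re]
    simp only [RCLike.re_to_complex] at h
    linarith
  have hcross : (inner ℂ w (v₀ - v)).re ≤ p * (‖v₀‖ + ‖v‖) + B := by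
    have hproj : ‖inner ℂ (K.starProjection w) (v₀ - v)‖ ≤ p * (‖v₀‖ + ‖v‖) :=
      (norm_inner_le_norm _ _).trans
        (mul_le_mul_of_nonneg_left (norm_sub_le _ _) (norm_nonneg _))
    rw [← K.starProjection_add_starProjection_orthogonal w, inner_add_left]
    exact (Complex.re_le_norm _).trans (norm_add_le_of_le hproj hB)
  -- AM-GM: `2 p ‖v‖ ≤ ‖v‖² / 2 + 2 p²` and `2 p ‖v₀‖ ≤ ‖v₀‖² + p²`
  linarith [sq_nonneg (‖v‖ - 2 * p), sq_nonneg (‖v₀‖ - p), sq_nonneg ‖v₀‖]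

theorem IsPredictLSE.norm_window_error_sq_le {n h : ℕ} {r σ B : ℝ} {x z φ ψ : ℤ → ℂ}
    (hφ : IsPredictLSE n h r (observedSeq x σ z) φ) (hψ : ψ ∈ predictFeasible n h r)
    (K : Submodule ℂ (EuclideanSpace ℂ (Finset.Icc (h : ℤ) (n + h)))) (hσ : 0 ≤ σ)
    (hB : ‖inner ℂ (Kᗮ.starProjection (window (Finset.Icc (h : ℤ) (n + h)) z))
      (window (Finset.Icc (h : ℤ) (n + h)) (convSeq (φ - ψ) (observedSeq x σ z)))‖ ≤ B) :
    ‖window (Finset.Icc (h : ℤ) (n + h)) (x - convSeq φ (observedSeq x σ z))‖ ^ 2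
      ≤ 4 * ‖window (Finset.Icc (h : ℤ) (n + h)) (x - convSeq ψ (observedSeq x σ z))‖ ^ 2
        + 6 * σ ^ 2 * ‖K.starProjection (window (Finset.Icc (h : ℤ) (n + h)) z)‖ ^ 2
        + 4 * σ * B := by
  let T := Finset.Icc (h : ℤ) (n + h)
  let y := observedSeq x σ z
  have hresidual (θ : ℤ → ℂ) :
      window T (y - convSeq θ y) = window T (x - convSeq θ y) + (σ : ℂ) • window T z := by
    rw [← map_smul, ← map_add]
    congr 1
    simp only [y, observedSeq_eq_add_smul x σ z]
    abel
  have hmin := hφ.2 hψ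
  simp only [Set.mem_ofPred_eq, windowNorm_shiftSeq] at hmin
  change ‖window T (y - convSeq φ y)‖ ^ 2 ≤ ‖window T (y - convSeq ψ y)‖ ^ 2 at hmin
  rw [hresidual, hresidual] at hmin
  have hdiff : window T (x - convSeq ψ y) - window T (x - convSeq φ y)
      = window T (convSeq (φ - ψ) y) := by
    rw [← map_sub, sub_sub_sub_cancel_left, sub_convSeq hφ.1.1 hψ.1]
  have hcross : ‖inner ℂ (Kᗮ.starProjection ((σ : ℂ) • window T z))
      (window T (x - convSeq ψ y) - window T (x - convSeq φ y))‖ ≤ σ * B := by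
    rw [hdiff, map_smul, inner_smul_left, norm_mul, RCLike.norm_conj,
      Complex.norm_of_nonneg hσ]
    exact mul_le_mul_of_nonneg_left hB hσ
  refine (norm_sq_le_of_norm_add_sq_le K hmin hcross).trans_eq ?_
  rw [map_smul, norm_smul, Complex.norm_of_nonneg hσ]
  ring

theorem convSeq_mem_of_shiftSeq_mem {S : Submodule ℂ (ℤ → ℂ)} (hS : ∀ u ∈ S, shiftSeq 1 u ∈ S)
    {a b : ℤ} (ha : 0 ≤ a) {δ : ℤ → ℂ} (hδ : δ ∈ seqSupportedOn a b) {u : ℤ → ℂ} (hu : u ∈ S) :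
    convSeq δ u ∈ S := by
  have hshift (k : ℕ) : shiftSeq k u ∈ S := by
    induction k with
    | zero =>
      have hzero : shiftSeq ((0 : ℕ) : ℤ) u = u := funext fun t => congrArg u (sub_zero t)
      rwa [hzero]
    | succ k ih =>
      have hsucc : shiftSeq ((k + 1 : ℕ) : ℤ) u = shiftSeq 1 (shiftSeq k u) :=
        funext fun t => congrArg u (by omega)
      rw [hsucc]
      exact hS _ ih
  have hsum : convSeq δ u = ∑ τ ∈ Finset.Icc a b, δ τ • shiftSeq τ u := by
    funext t
    rw [convSeq_eq_sum hδ subset_rfl, Finset.sum_apply]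
    rfl
  rw [hsum]
  refine S.sum_mem fun τ hτ => S.smul_mem _ ?_
  obtain ⟨k, rfl⟩ := Int.eq_ofNat_of_zero_le (ha.trans (Finset.mem_Icc.1 hτ).1)
  exact hshift k

theorem norm_inner_window_convSeq_observedSeq_le {n : ℕ} {h : ℤ} (hh : 0 ≤ h)
    {S : Submodule ℂ (ℤ → ℂ)} (hS : ∀ u ∈ S, shiftSeq 1 u ∈ S) {xS : ℤ → ℂ} (hxS : xS ∈ S)
    {T : Finset ℤ} {w : EuclideanSpace ℂ T} (hw : w ∈ (S.map (window T))ᗮ) {σ R R' : ℝ}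
    (hσ : 0 ≤ σ) {ε z δ : ℤ → ℂ} (hδ : δ ∈ seqSupportedOn h (n + h))
    (hε : ∀ k ∈ Finset.range (n + 1),
      ‖inner ℂ w (window T (convSeq (harmonicFilter n h k) ε))‖ ≤ R)
    (hz : ∀ k ∈ Finset.range (n + 1),
      ‖inner ℂ w (window T (convSeq (harmonicFilter n h k) z))‖ ≤ R') :
    ‖inner ℂ w (window T (convSeq δ (observedSeq (xS + ε) σ z)))‖
      ≤ dftNormOne n (shiftSeq (-h) δ) * (R + σ * R') := by
  have horth : inner ℂ w (window T (convSeq δ xS)) = 0 :=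
    Submodule.inner_left_of_mem_orthogonal
      (Submodule.mem_map_of_mem (convSeq_mem_of_shiftSeq_mem hS hh hδ hxS)) hw
  rw [convSeq_observedSeq hδ, (isLinearMap_convSeq hδ).map_add, map_add, map_add, map_smul,
    inner_add_right, inner_add_right, horth, zero_add, inner_smul_right, mul_add]
  refine norm_add_le_of_le (norm_inner_window_convSeq_le_dftNormOne_mul hδ hε) ?_
  rw [norm_mul, Complex.norm_of_nonneg hσ, mul_left_comm]
  exact mul_le_mul_of_nonneg_left (norm_inner_window_convSeq_le_dftNormOne_mul hδ hz) hσ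

theorem sub_convSeq_observedSeq_eq {q φ : ℤ → ℂ} {a b c d : ℤ} (hq : q ∈ seqSupportedOn a b)
    (hφ : φ ∈ seqSupportedOn c d) (x : ℤ → ℂ) (σ : ℝ) (z : ℤ → ℂ) :
    x - convSeq φ (observedSeq x σ z)
      = convSeq q (x - convSeq φ (observedSeq x σ z)) + (x - convSeq q x)
        - convSeq φ (x - convSeq q x) - (σ : ℂ) • convSeq φ z
        + (σ : ℂ) • convSeq φ (convSeq q z) := by
  simp only [convSeq_observedSeq hφ, (isLinearMap_convSeq hq).map_sub,
    (isLinearMap_convSeq hq).map_add, (isLinearMap_convSeq hq).map_smul,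
    (isLinearMap_convSeq hφ).map_sub, convSeq_left_comm hq hφ]
  abel

/-- The noise realizations for which the error bounds hold. Here `q` is the oracle filter with
delay `h`, `K` the space of windows of the shift-invariant subspace and `s` its dimension, `ε` the
deviation of the signal from that subspace and `η` the norm of the windows of `ε`. The confidence
levels enter through `l` for the individual events and through `l'` for those indexed by a frequency
or a time. -/
structure IsGoodNoise (m n h s : ℕ) (ρ η l l' : ℝ)
    (K : Submodule ℂ (EuclideanSpace ℂ (Finset.Icc ((2 * h : ℕ) : ℤ) (n + (2 * h : ℕ)))))
    (q ε z : ℤ → ℂ) : Prop where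
  oracle_le : ‖window (Finset.Icc ((2 * h : ℕ) : ℤ) (n + (2 * h : ℕ)))
    (convSeq (convSeq q q) z)‖ ^ 2 ≤ 4 * ρ ^ 2 * (1 + l)
  projection_le : ‖K.starProjection (window _ z)‖ ^ 2 ≤ 4 * (s + l)
  deviation_le : ∑ k ∈ Finset.range (n + 1), ‖inner ℂ (Kᗮ.starProjection (window _ z))
    (window _ (convSeq (harmonicFilter n (2 * h : ℕ) k) ε))‖ ^ 2 ≤ 4 * ((n + 1) * η ^ 2) * (1 + l)
  harmonic_cross_le : ∀ k ∈ Finset.range (n + 1), ‖inner ℂ (Kᗮ.starProjection (window _ z))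
    (window _ (convSeq (harmonicFilter n (2 * h : ℕ) k) z))‖ ≤ 8 * √((n : ℝ) + 1) * (√s + 1 + l')
  harmonic_apply_le : ∀ k ∈ Finset.range (n + 1),
    ∀ t ∈ Finset.Icc ((m : ℤ) + 3 * h) (n + 3 * h),
      ‖convSeq (harmonicFilter n (2 * h : ℕ) k) z t‖ ^ 2 ≤ 4 * (1 + l')
  filtered_le : ‖window (Finset.Icc (-(m : ℤ) + h) (n + h)) (convSeq q z)‖ ^ 2 ≤ 8 * ρ * (1 + l)

theorem sum_norm_sq_le_of_mem_predictFeasible {n h : ℕ} {r : ℝ} {φ : ℤ → ℂ}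
    (hφ : φ ∈ predictFeasible n h r) :
    ∑ τ ∈ Finset.Icc (h : ℤ) (n + h), ‖φ τ‖ ^ 2 ≤ r ^ 2 / (n + 1) := by
  refine (sum_norm_sq_le_dftNormOne_shiftSeq_sq n h φ).trans ((pow_le_pow_left₀
    (Finset.sum_nonneg fun _ _ => norm_nonneg _) hφ.2 2).trans_eq ?_)
  rw [div_pow, Real.sq_sqrt (by positivity)]

theorem norm_convSeq_sq_le_of_mem_predictFeasible {n h : ℕ} {r : ℝ} {φ : ℤ → ℂ}
    (hφ : φ ∈ predictFeasible n h r) (v : ℤ → ℂ) (t : ℤ) :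
    ‖convSeq φ v t‖ ^ 2 ≤ r ^ 2 / (n + 1) * ∑ j ∈ Finset.Icc (t - (n + h)) (t - h), ‖v j‖ ^ 2 :=
  (norm_convSeq_sq_le hφ.1 v t).trans
    (mul_le_mul_of_nonneg_right (sum_norm_sq_le_of_mem_predictFeasible hφ) (by positivity))

theorem norm_convSeq_sq_le_of_harmonicFilter_le {n h : ℕ} {r V : ℝ} {φ v : ℤ → ℂ} {t : ℤ}
    (hφ : φ ∈ predictFeasible n h r)
    (hV : ∀ k ∈ Finset.range (n + 1), ‖convSeq (harmonicFilter n h k) v t‖ ^ 2 ≤ V) :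
    ‖convSeq φ v t‖ ^ 2 ≤ r ^ 2 / (n + 1) * V := by
  have hV₀ : 0 ≤ V := (sq_nonneg _).trans (hV 0 (Finset.mem_range.2 n.succ_pos))
  have hnorm : ‖convSeq φ v t‖ ≤ r / √((n : ℝ) + 1) * √V :=
    (norm_convSeq_le_dftNormOne_mul hφ.1 fun k hk => Real.le_sqrt_of_sq_le (hV k hk)).trans
      (mul_le_mul_of_nonneg_right hφ.2 (Real.sqrt_nonneg V))
  refine (pow_le_pow_left₀ (norm_nonneg _) hnorm 2).trans_eq ?_
  rw [mul_pow, div_pow, Real.sq_sqrt (by positivity), Real.sq_sqrt hV₀]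

theorem dftNormOne_shiftSeq_sub_le_of_mem_predictFeasible {n h : ℕ} {r r' : ℝ} {φ ψ : ℤ → ℂ}
    (hφ : φ ∈ predictFeasible n h r) (hψ : ψ ∈ predictFeasible n h r') :
    dftNormOne n (shiftSeq (-h) (φ - ψ)) ≤ (r + r') / √((n : ℝ) + 1) := by
  rw [add_div]
  exact (dftNormOne_sub_le n (shiftSeq (-h) φ) (shiftSeq (-h) ψ)).trans (add_le_add hφ.2 hψ.2)

namespace IsOracleFilter

variable {m n h : ℕ} {ρ σ : ℝ} {x q : ℤ → ℂ}

theorem norm_convSeq_apply_sq_le (hq : IsOracleFilter m (n + 2 * h) h ρ σ x q) (hn : n = 2 * m)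
    (hρ : 0 ≤ ρ) (v : ℤ → ℂ) {t : ℤ} (ht : (m : ℤ) + 3 * h ≤ t) (ht' : t ≤ n + 3 * h) :
    ‖convSeq q v t‖ ^ 2
      ≤ ρ / (n + 1) * ‖window (Finset.Icc ((2 * h : ℕ) : ℤ) (n + (2 * h : ℕ))) v‖ ^ 2 := by
  rw [norm_window_sq]
  refine (norm_convSeq_sq_le hq.mem_seqSupportedOn v t).trans (mul_le_mul (hq.energy_le.trans ?_)
    (Finset.sum_le_sum_of_subset_of_nonneg (Finset.Icc_subset_Icc (by omega) (by omega))
      fun _ _ _ => sq_nonneg _) (by positivity) (by positivity))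
  refine div_le_div_of_nonneg_left hρ (by positivity) ?_
  rw [hn]
  push_cast
  linarith

theorem norm_bias_apply_sq_le (hq : IsOracleFilter m (n + 2 * h) h ρ σ x q) (hn : n = 2 * m)
    (hρ : 0 ≤ ρ) {t : ℤ} (ht : -(m : ℤ) + h ≤ t) (ht' : t ≤ n + 3 * h) :
    ‖(x - convSeq q x) t‖ ^ 2 ≤ ρ / (n + 1) * (2 * σ ^ 2) := by
  refine (hq.bias_le t ht (by push_cast; omega)).trans ?_
  rw [div_mul_eq_mul_div, div_le_div_iff₀ (by positivity) (by positivity), hn]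
  push_cast
  linarith [mul_nonneg hρ (sq_nonneg σ)]

theorem norm_convSeq_bias_apply_sq_le (hq : IsOracleFilter m (n + 2 * h) h ρ σ x q)
    (hn : n = 2 * m) (hρ : 0 ≤ ρ) {r : ℝ} {φ : ℤ → ℂ} (hφ : φ ∈ predictFeasible n (2 * h) r)
    {t : ℤ} (ht : (m : ℤ) + 3 * h ≤ t) (ht' : t ≤ n + 3 * h) :
    ‖convSeq φ (x - convSeq q x) t‖ ^ 2 ≤ r ^ 2 / (n + 1) * (2 * ρ * σ ^ 2) := by
  refine (norm_convSeq_sq_le_of_mem_predictFeasible hφ _ t).trans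
    (mul_le_mul_of_nonneg_left ?_ (by positivity))
  refine (hq.sum_norm_bias_sq_le (k := n) (by ring) (by push_cast; omega)
    (by push_cast; omega)).trans ?_
  rw [mul_div_assoc', div_le_iff₀ (by positivity), hn]
  push_cast
  linarith [mul_nonneg hρ (sq_nonneg σ)]

end IsOracleFilter

namespace IsGoodNoise

variable {m n h s : ℕ} {ρ σ ϰ η l l' : ℝ} {q x xS ε z φ : ℤ → ℂ}
  {K : Submodule ℂ (EuclideanSpace ℂ (Finset.Icc ((2 * h : ℕ) : ℤ) (n + (2 * h : ℕ))))}

theorem norm_window_oracle_error_sq_le (hz : IsGoodNoise m n h s ρ (ϰ * σ) l l' K q ε z)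
    (hq : IsOracleFilter m (n + 2 * h) h ρ σ x q) (hn : n = 2 * m) (hρ : 1 ≤ ρ) (hl : 0 ≤ l) :
    ‖window (Finset.Icc ((2 * h : ℕ) : ℤ) (n + (2 * h : ℕ)))
      (x - convSeq (convSeq q q) (observedSeq x σ z))‖ ^ 2 ≤ 20 * σ ^ 2 * (ρ ^ 2 * (1 + l)) := by
  have hsplit : x - convSeq (convSeq q q) (observedSeq x σ z)
      = (x - convSeq (convSeq q q) x) + (-σ : ℂ) • convSeq (convSeq q q) z := by
    rw [convSeq_observedSeq (hq.convSeq_self_mem_predictFeasible hn).1, neg_smul]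
    abel
  have hbias := hq.norm_window_bias_convSeq_self_sq_le hn hρ
  have hnoise := mul_le_mul_of_nonneg_left hz.oracle_le (sq_nonneg σ)
  rw [hsplit, map_add, map_smul]
  refine (norm_add_sq_le_two_mul _ _).trans ?_
  rw [norm_smul, norm_neg, Complex.norm_real, mul_pow, Real.norm_eq_abs, sq_abs]
  have hl_mul : 0 ≤ σ ^ 2 * ρ ^ 2 * l := by positivity
  linarith

theorem norm_inner_window_convSeq_le {S : Submodule ℂ (ℤ → ℂ)}
    (hz : IsGoodNoise m n h s ρ (ϰ * σ) l l' (S.map (window _)) q ε z)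
    (hS : ∀ u ∈ S, shiftSeq 1 u ∈ S) (hxS : xS ∈ S) (hσ : 0 ≤ σ) (hϰ : 0 ≤ ϰ) (hl : 0 ≤ l)
    (hl' : 0 ≤ l') {r : ℝ} {δ : ℤ → ℂ} (hδ : δ ∈ predictFeasible n (2 * h) r) :
    ‖inner ℂ ((S.map (window (Finset.Icc ((2 * h : ℕ) : ℤ) (n + (2 * h : ℕ)))))ᗮ.starProjection
        (window _ z)) (window _ (convSeq δ (observedSeq (xS + ε) σ z)))‖
      ≤ r * σ * (2 * ϰ * √(1 + l) + 8 * (√s + 1 + l')) := by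
  have hdeviation (k) (hk : k ∈ Finset.range (n + 1)) :
      ‖inner ℂ ((S.map (window (Finset.Icc ((2 * h : ℕ) : ℤ) (n + (2 * h : ℕ)))))ᗮ.starProjection
        (window _ z)) (window _ (convSeq (harmonicFilter n (2 * h : ℕ) k) ε))‖
        ≤ √((n : ℝ) + 1) * (2 * (ϰ * σ) * √(1 + l)) := by
    refine le_of_sq_le_sq ?_ (by positivity)
    refine ((Finset.single_le_sum (fun _ _ => sq_nonneg _) hk).trans hz.deviation_le).trans_eq ?_
    rw [mul_pow √((n : ℝ) + 1), mul_pow (2 * (ϰ * σ)), Real.sq_sqrt (by positivity),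
      Real.sq_sqrt (by positivity)]
    ring
  refine (norm_inner_window_convSeq_observedSeq_le (by positivity) hS hxS
    (Submodule.starProjection_apply_mem _ _) hσ hδ.1 hdeviation hz.harmonic_cross_le).trans
    ((mul_le_mul_of_nonneg_right hδ.2 (by positivity)).trans_eq ?_)
  field_simp

theorem norm_window_error_sq_le {S : Submodule ℂ (ℤ → ℂ)}
    (hz : IsGoodNoise m n h s ρ (ϰ * σ) l l' (S.map (window _)) q ε z)
    (hq : IsOracleFilter m (n + 2 * h) h ρ σ (xS + ε) q) (hS : ∀ u ∈ S, shiftSeq 1 u ∈ S)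
    (hxS : xS ∈ S) (hn : n = 2 * m) (hρ : 1 ≤ ρ) (hσ : 0 ≤ σ) (hϰ : 0 ≤ ϰ) (hl : 0 ≤ l)
    (hl' : 0 ≤ l') (hφ : IsPredictLSE n (2 * h) (2 * ρ) (observedSeq (xS + ε) σ z) φ) :
    ‖window (Finset.Icc ((2 * h : ℕ) : ℤ) (n + (2 * h : ℕ)))
        (xS + ε - convSeq φ (observedSeq (xS + ε) σ z))‖ ^ 2
      ≤ σ ^ 2 * (80 * (ρ ^ 2 * (1 + l)) + 24 * (s + l) + 24 * (ρ * ϰ * √(1 + l))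
        + 96 * (ρ * (√s + 1 + l'))) := by
  have horacle := hq.convSeq_self_mem_predictFeasible hn
  have hfeasible : convSeq q q ∈ predictFeasible n (2 * h) (2 * ρ) := by
    refine ⟨horacle.1, horacle.2.trans ?_⟩
    gcongr
    linarith
  have hdiff : φ - convSeq q q ∈ predictFeasible n (2 * h) (2 * ρ + ρ) :=
    ⟨fun t ht => by rw [Pi.sub_apply, hφ.1.1 t ht, horacle.1 t ht, sub_zero],
      dftNormOne_shiftSeq_sub_le_of_mem_predictFeasible hφ.1 horacle⟩
  have herror := hφ.norm_window_error_sq_le hfeasible _ hσ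
    (hz.norm_inner_window_convSeq_le hS hxS hσ hϰ hl hl' hdiff)
  have horacle_error := hz.norm_window_oracle_error_sq_le hq hn hρ hl
  have hprojection := mul_le_mul_of_nonneg_left hz.projection_le (sq_nonneg σ)
  linarith

theorem norm_convSeq_apply_sq_le (hz : IsGoodNoise m n h s ρ η l l' K q ε z)
    {r : ℝ} (hφ : φ ∈ predictFeasible n (2 * h) r) {t : ℤ} (ht : (m : ℤ) + 3 * h ≤ t)
    (ht' : t ≤ n + 3 * h) :
    ‖convSeq φ z t‖ ^ 2 ≤ r ^ 2 / (n + 1) * (4 * (1 + l')) :=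
  norm_convSeq_sq_le_of_harmonicFilter_le hφ fun k hk =>
    hz.harmonic_apply_le k hk t (Finset.mem_Icc.2 ⟨ht, ht'⟩)

theorem norm_convSeq_convSeq_sq_le (hz : IsGoodNoise m n h s ρ η l l' K q ε z) (hn : n = 2 * m)
    {r : ℝ} (hφ : φ ∈ predictFeasible n (2 * h) r) {t : ℤ} (ht : (m : ℤ) + 3 * h ≤ t)
    (ht' : t ≤ n + 3 * h) :
    ‖convSeq φ (convSeq q z) t‖ ^ 2 ≤ r ^ 2 / (n + 1) * (8 * ρ * (1 + l)) := by
  have hfiltered := hz.filtered_le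
  rw [norm_window_sq] at hfiltered
  refine (norm_convSeq_sq_le_of_mem_predictFeasible hφ _ t).trans
    (mul_le_mul_of_nonneg_left (le_trans ?_ hfiltered) (by positivity))
  exact Finset.sum_le_sum_of_subset_of_nonneg
    (Finset.Icc_subset_Icc (by push_cast; omega) (by push_cast; omega)) fun _ _ _ => sq_nonneg _

theorem norm_error_apply_sq_le (hz : IsGoodNoise m n h s ρ η l l' K q ε z)
    (hq : IsOracleFilter m (n + 2 * h) h ρ σ x q) (hn : n = 2 * m) (hρ : 0 ≤ ρ)
    (hφ : φ ∈ predictFeasible n (2 * h) (2 * ρ)) {t : ℤ} (ht : (m : ℤ) + 3 * h ≤ t)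
    (ht' : t ≤ n + 3 * h) :
    ‖(x - convSeq φ (observedSeq x σ z)) t‖ ^ 2 ≤ 5 * (ρ / (n + 1)) *
      (‖window (Finset.Icc ((2 * h : ℕ) : ℤ) (n + (2 * h : ℕ)))
          (x - convSeq φ (observedSeq x σ z))‖ ^ 2
        + σ ^ 2 * (2 + 8 * ρ ^ 2 + 16 * (ρ * (1 + l')) + 32 * (ρ ^ 2 * (1 + l)))) := by
  let e := x - convSeq φ (observedSeq x σ z)
  let g := x - convSeq q x
  have hdecomp : e t = ∑ i, ![convSeq q e t, g t, -convSeq φ g t, -((σ : ℂ) * convSeq φ z t),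
      (σ : ℂ) * convSeq φ (convSeq q z) t] i := by
    simp only [Fin.sum_univ_five, Matrix.cons_val, ← sub_eq_add_neg]
    exact congrFun (sub_convSeq_observedSeq_eq hq.mem_seqSupportedOn hφ.1 x σ z) t
  have hsum := norm_sum_sq_le_card_mul Finset.univ
    ![convSeq q e t, g t, -convSeq φ g t, -((σ : ℂ) * convSeq φ z t),
      (σ : ℂ) * convSeq φ (convSeq q z) t]
  rw [← hdecomp] at hsum
  simp only [Finset.card_univ, Fintype.card_fin, Fin.sum_univ_five, Matrix.cons_val, norm_neg,
    norm_mul, Complex.norm_real, Real.norm_eq_abs, mul_pow, sq_abs] at hsum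
  have herror := hq.norm_convSeq_apply_sq_le hn hρ e ht ht'
  have hbias := hq.norm_bias_apply_sq_le hn hρ (by omega) ht'
  have hfiltered_bias := hq.norm_convSeq_bias_apply_sq_le hn hρ hφ ht ht'
  have hnoise := mul_le_mul_of_nonneg_left
    (hz.norm_convSeq_apply_sq_le hφ ht ht') (sq_nonneg σ)
  have hfiltered_noise := mul_le_mul_of_nonneg_left
    (hz.norm_convSeq_convSeq_sq_le hn hφ ht ht') (sq_nonneg σ)
  refine hsum.trans ((mul_le_mul_of_nonneg_left (add_le_add (add_le_add (add_le_add
    (add_le_add herror hbias) hfiltered_bias) hnoise) hfiltered_noise) (by norm_num)).trans_eq ?_)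
  ring

end IsGoodNoise

/-! ### The probability of good noise -/

theorem sum_norm_sq_window_convSeq_harmonicFilter_le {n : ℕ} {ε : ℤ → ℂ} {η : ℝ} (H : ℤ)
    (hε : ∀ τ : ℤ, 0 ≤ τ → τ ≤ n → windowNorm n (shiftSeq τ ε) ≤ η) :
    ∑ k ∈ Finset.range (n + 1),
        ‖window (Finset.Icc H (n + H)) (convSeq (harmonicFilter n H k) ε)‖ ^ 2
      ≤ (n + 1) * η ^ 2 := by
  have hlag (t : ℤ) : ∑ τ ∈ Finset.Icc (t - H - n) (t - H), ‖ε τ‖ ^ 2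
      = ∑ τ ∈ Finset.Icc (0 : ℤ) n, ‖shiftSeq τ ε (t - H)‖ ^ 2 := by
    have hreflect := sum_Icc_reflect (fun τ => ‖ε τ‖ ^ 2) 0 n (t - H)
    rw [sub_zero] at hreflect
    exact hreflect.symm
  have hwindow (τ : ℤ) : ∑ t ∈ Finset.Icc H (n + H), ‖shiftSeq τ ε (t - H)‖ ^ 2
      = windowNorm n (shiftSeq τ ε) ^ 2 := by
    rw [sum_Icc_shift fun t => ‖shiftSeq τ ε t‖ ^ 2, sub_self, add_sub_cancel_right, windowNorm,
      Real.sq_sqrt (by positivity), sum_range_eq_sum_Icc fun t => ‖shiftSeq τ ε t‖ ^ 2]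
  simp only [norm_window_sq]
  rw [Finset.sum_comm]
  simp only [sum_norm_sq_convSeq_harmonicFilter, hlag]
  rw [Finset.sum_comm]
  simp only [hwindow]
  refine (Finset.sum_le_card_nsmul _ _ (η ^ 2) fun τ hτ => ?_).trans_eq ?_
  · rw [Finset.mem_Icc] at hτ
    exact pow_le_pow_left₀ (Real.sqrt_nonneg _) (hε τ hτ.1 hτ.2) 2
  · rw [nsmul_eq_mul, Int.card_Icc, sub_zero, Int.toNat_natCast_add_one]
    push_cast
    rfl

section GoodNoise

variable {Ω : Type*} [MeasurableSpace Ω] {μ : Measure Ω} [IsProbabilityMeasure μ]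
  {ζ : ℤ → Ω → ℂ} {m n h s : ℕ} {ρ σ η β β' : ℝ} {x q ε : ℤ → ℂ}

theorem IsStdComplexGaussianNoise.isNoiseEvent_norm_window_convSeq_of_mem_predictFeasible
    (hζ : IsStdComplexGaussianNoise μ ζ) {r : ℝ} {ψ : ℤ → ℂ} (hψ : ψ ∈ predictFeasible n h r)
    (hβ : 0 < β) :
    IsNoiseEvent μ ζ β {z | ‖window (Finset.Icc (h : ℤ) (n + h)) (convSeq ψ z)‖ ^ 2
      ≤ 4 * r ^ 2 * (1 + Real.log (1 / β))} := by
  refine hζ.isNoiseEvent_norm_window_convSeq hψ.1 _ ?_ hβ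
  rw [card_Icc_add]
  refine (mul_le_mul_of_nonneg_left (sum_norm_sq_le_of_mem_predictFeasible hψ)
    (by positivity)).trans_eq ?_
  rw [mul_div_cancel₀]
  positivity

theorem IsOracleFilter.isNoiseEvent_norm_window_convSeq {N : ℕ}
    (hq : IsOracleFilter m N h ρ σ x q) (hζ : IsStdComplexGaussianNoise μ ζ) (hn : n = 2 * m)
    (hβ : 0 < β) :
    IsNoiseEvent μ ζ β {z | ‖window (Finset.Icc (-(m : ℤ) + h) (n + h)) (convSeq q z)‖ ^ 2
      ≤ 8 * ρ * (1 + Real.log (1 / β))} := by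
  have hcard : ((Finset.Icc (-(m : ℤ) + h) (n + h)).card : ℝ) ≤ 4 * (m + 1) := by
    rw [Int.card_Icc]
    exact_mod_cast (by omega : ((n : ℤ) + h + 1 - (-m + h)).toNat ≤ 4 * (m + 1))
  have henergy : (Finset.Icc (-(m : ℤ) + h) (n + h)).card
      * ∑ τ ∈ Finset.Icc (h : ℤ) (m + h), ‖q τ‖ ^ 2 ≤ 2 * ρ := by
    refine (mul_le_mul hcard hq.energy_le (by positivity) (by positivity)).trans_eq ?_
    field_simp
    ring
  convert hζ.isNoiseEvent_norm_window_convSeq hq.mem_seqSupportedOn _ henergy hβ using 5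
  ring

theorem IsStdComplexGaussianNoise.isNoiseEvent_sum_norm_inner_starProjection_window
    (hζ : IsStdComplexGaussianNoise μ ζ) {T : Finset ℤ} (K : Submodule ℂ (EuclideanSpace ℂ T))
    {κ : Type*} {I : Finset κ} {e : κ → EuclideanSpace ℂ T} {V : ℝ}
    (hV : ∑ k ∈ I, ‖e k‖ ^ 2 ≤ V) (hβ : 0 < β) :
    IsNoiseEvent μ ζ β {z | ∑ k ∈ I, ‖inner ℂ (K.starProjection (window T z)) (e k)‖ ^ 2
      ≤ 4 * V * (1 + Real.log (1 / β))} := by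
  have hproj : ∑ k ∈ I, ‖K.starProjection (e k)‖ ^ 2 ≤ V :=
    (Finset.sum_le_sum fun k _ => pow_le_pow_left₀ (norm_nonneg _)
      (K.norm_starProjection_apply_le (e k)) 2).trans hV
  have hsymm (w) (k) : ‖inner ℂ (K.starProjection w) (e k)‖
      = ‖inner ℂ (K.starProjection (e k)) w‖ := by
    rw [K.inner_starProjection_left_eq_right, norm_inner_symm]
  simp only [hsymm]
  exact hζ.isNoiseEvent_sum_norm_inner_window hproj hβ

theorem IsStdComplexGaussianNoise.isNoiseEvent_norm_convSeq_harmonicFilter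
    (hζ : IsStdComplexGaussianNoise μ ζ) (n : ℕ) (H : ℤ) (k : ℕ) (t : ℤ) (hβ : 0 < β) :
    IsNoiseEvent μ ζ β
      {z | ‖convSeq (harmonicFilter n H k) z t‖ ^ 2 ≤ 4 * (1 + Real.log (1 / β))} := by
  have hV : (({t} : Finset ℤ).card : ℝ)
      * ∑ τ ∈ Finset.Icc H (n + H), ‖harmonicFilter n H k τ‖ ^ 2 ≤ 1 := by
    rw [Finset.card_singleton, Nat.cast_one, one_mul]
    exact sum_norm_harmonicFilter_sq_le n H k
  have hevent := hζ.isNoiseEvent_norm_window_convSeq (harmonicFilter_mem_seqSupportedOn n H k)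
    {t} hV hβ
  simpa only [norm_window_sq, Finset.sum_singleton, mul_one] using hevent

theorem IsStdComplexGaussianNoise.isNoiseEvent_norm_inner_orthogonal_harmonicFilter
    (hζ : IsStdComplexGaussianNoise μ ζ) {H : ℤ}
    (K : Submodule ℂ (EuclideanSpace ℂ (Finset.Icc H (n + H)))) (hs : 1 ≤ s)
    (hK : Module.finrank ℂ K ≤ s) (k : ℕ) (hβ : 0 < β) :
    IsNoiseEvent μ ζ (4 * β) {z | ‖inner ℂ (Kᗮ.starProjection (window _ z))
      (window _ (convSeq (harmonicFilter n H k) z))‖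
        ≤ 8 * √((n : ℝ) + 1) * (√s + 1 + Real.log (1 / β))} := by
  have hV : ((Finset.Icc H (n + H)).card : ℝ)
      * ∑ τ ∈ Finset.Icc H (n + H), ‖harmonicFilter n H k τ‖ ^ 2 ≤ n + 1 := by
    rw [card_Icc_add]
    exact mul_le_of_le_one_right (by positivity) (sum_norm_harmonicFilter_sq_le n H k)
  have hmeas : Measurable fun z => ‖inner ℂ (Kᗮ.starProjection (window _ z))
      (window (Finset.Icc H (n + H)) (convSeq (harmonicFilter n H k) z))‖ :=
    ((Kᗮ.starProjection.measurable.comp (measurable_window _)).inner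
      ((measurable_window _).comp
        (measurable_convSeq (harmonicFilter_mem_seqSupportedOn n H k)))).norm
  refine (hζ.isNoiseEvent_norm_inner_orthogonal_window_convSeq
    (harmonicFilter_mem_seqSupportedOn n H k) K (by positivity) hV hβ).sublevel_mono hmeas ?_
  have hzero : ‖harmonicFilter n H k 0‖ ≤ (√((n : ℝ) + 1))⁻¹ := by
    rw [← Real.sqrt_inv]
    exact Real.le_sqrt_of_sq_le (norm_harmonicFilter_sq_le n H k 0)
  have htrace : ((n : ℝ) + 1) * ‖harmonicFilter n H k 0‖ ≤ √((n : ℝ) + 1) * √s := by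
    refine (mul_le_mul_of_nonneg_left hzero (by positivity)).trans ?_
    rw [← div_eq_mul_inv, Real.div_sqrt]
    exact le_mul_of_one_le_right (Real.sqrt_nonneg _) (Real.one_le_sqrt.2 (mod_cast hs))
  have hrank : √(Module.finrank ℂ K) * √((n : ℝ) + 1) ≤ √((n : ℝ) + 1) * √s := by
    rw [mul_comm]
    gcongr
  rw [card_Icc_add]
  linarith

theorem IsOracleFilter.isNoiseEvent_isGoodNoise {N : ℕ} (hq : IsOracleFilter m N h ρ σ x q)
    (hζ : IsStdComplexGaussianNoise μ ζ) (hn : n = 2 * m)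
    (K : Submodule ℂ (EuclideanSpace ℂ (Finset.Icc ((2 * h : ℕ) : ℤ) (n + (2 * h : ℕ)))))
    (hs : 1 ≤ s) (hK : Module.finrank ℂ K ≤ s)
    (hε : ∀ τ : ℤ, 0 ≤ τ → τ ≤ n → windowNorm n (shiftSeq τ ε) ≤ η) (hβ : 0 < β) (hβ' : 0 < β') :
    IsNoiseEvent μ ζ (4 * β + (n + 1) * ((m + 5) * β'))
      {z | IsGoodNoise m n h s ρ η (Real.log (1 / β)) (Real.log (1 / β')) K q ε z} := by
  have hpath := hζ.measurable_path
  have horacle := hζ.isNoiseEvent_norm_window_convSeq_of_mem_predictFeasible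
    (hq.convSeq_self_mem_predictFeasible hn) hβ
  have hprojection := (hζ.isNoiseEvent_norm_starProjection_window _ K hβ).sublevel_mono
    ((K.starProjection.measurable.comp (measurable_window _)).norm.pow_const 2)
    (R' := 4 * (s + Real.log (1 / β))) (by gcongr)
  have hdeviation := hζ.isNoiseEvent_sum_norm_inner_starProjection_window Kᗮ
    (sum_norm_sq_window_convSeq_harmonicFilter_le (2 * h : ℕ) hε) hβ
  have hcross := IsNoiseEvent.biInter hpath (Finset.range (n + 1)) fun k _ =>
    hζ.isNoiseEvent_norm_inner_orthogonal_harmonicFilter K hs hK k hβ'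
  have happly := IsNoiseEvent.biInter hpath (Finset.range (n + 1)) fun k _ =>
    IsNoiseEvent.biInter hpath (Finset.Icc ((m : ℤ) + 3 * h) (n + 3 * h)) fun t _ =>
      hζ.isNoiseEvent_norm_convSeq_harmonicFilter n (2 * h : ℕ) k t hβ'
  have hfiltered := hq.isNoiseEvent_norm_window_convSeq hζ hn hβ
  have hcard : ((Finset.Icc ((m : ℤ) + 3 * h) (n + 3 * h)).card : ℝ) = m + 1 := by
    rw [← card_Icc_add m (m + 3 * h), hn]
    congr 3
    push_cast
    ring
  convert (horacle.inter hpath hprojection).inter hpath (hdeviation.inter hpath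
    (hcross.inter hpath (happly.inter hpath hfiltered))) using 1
  · rw [hcard, Finset.card_range]
    push_cast
    ring
  · ext z
    simp only [Set.mem_inter_iff, Set.mem_iInter, Set.mem_ofPred_eq]
    exact ⟨fun hz => ⟨⟨hz.oracle_le, hz.projection_le⟩, hz.deviation_le, hz.harmonic_cross_le,
      hz.harmonic_apply_le, hz.filtered_le⟩,
      fun ⟨⟨h₁, h₂⟩, h₃, h₄, h₅, h₆⟩ => ⟨h₁, h₂, h₃, h₄, h₅, h₆⟩⟩

end GoodNoise

/-! ### The remainder term -/

theorem log_one_div_div {c α : ℝ} (hc : c ≠ 0) (hα : α ≠ 0) :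
    Real.log (1 / (α / c)) = Real.log c + Real.log (1 / α) := by
  rw [one_div_div, Real.log_div hc hα, one_div, Real.log_inv, sub_eq_add_neg]

theorem log_one_div_div_nonneg {c α : ℝ} (hc : 1 ≤ c) (hα₀ : 0 < α) (hα₁ : α ≤ 1) :
    0 ≤ Real.log (1 / (α / c)) := by
  rw [log_one_div_div (by positivity) hα₀.ne']
  exact add_nonneg (Real.log_nonneg hc) (Real.log_nonneg (one_le_one_div hα₀ hα₁))

theorem one_add_log_div_eight_le {α : ℝ} (hα₀ : 0 < α) (hα₁ : α ≤ 1) :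
    1 + Real.log (1 / (α / 8)) ≤ 4 * (1 + Real.log (1 / α)) := by
  have hlog_eight : Real.log 8 ≤ 3 := by
    rw [show (8 : ℝ) = 2 ^ 3 by norm_num, Real.log_pow]
    push_cast
    linarith [Real.log_two_lt_d9]
  rw [log_one_div_div (by norm_num) hα₀.ne']
  linarith [Real.log_nonneg (one_le_one_div hα₀ hα₁)]

theorem one_add_log_div_sq_le {m n : ℕ} (hm : 1 ≤ m) (hn : n = 2 * m) {α : ℝ} (hα₀ : 0 < α)
    (hα₁ : α ≤ 1) :
    1 + Real.log (1 / (α / (16 * ((n : ℝ) + 1) ^ 2))) ≤ 6 * Real.log (((m : ℝ) + n) / α) := by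
  have hnm : ((n + 1 : ℕ) : ℝ) ≤ (m + n : ℕ) := by
    exact_mod_cast (by omega : n + 1 ≤ m + n)
  have hthree : ((3 : ℕ) : ℝ) ≤ (m + n : ℕ) := by
    exact_mod_cast (by omega : 3 ≤ m + n)
  push_cast at hnm hthree
  have hlog_sixteen : Real.log 16 ≤ 3 := by
    rw [show (16 : ℝ) = 2 ^ 4 by norm_num, Real.log_pow]
    push_cast
    linarith [Real.log_two_lt_d9]
  have hone : 1 ≤ Real.log ((m : ℝ) + n) := by
    rw [Real.le_log_iff_exp_le (by linarith)]
    linarith [Real.exp_one_lt_d9]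
  have hlog_le : Real.log ((n : ℝ) + 1) ≤ Real.log ((m : ℝ) + n) :=
    Real.log_le_log (by positivity) hnm
  have hlog_nonneg := Real.log_nonneg (one_le_one_div hα₀ hα₁)
  rw [log_one_div_div (by positivity) hα₀.ne', Real.log_mul (by norm_num) (by positivity),
    Real.log_pow, div_eq_mul_one_div ((m : ℝ) + n), Real.log_mul (by linarith) (by positivity)]
  push_cast
  linarith

section Remainder

variable {m n s : ℕ} {ρ η ϰ α l l' : ℝ}

theorem log_add_div_nonneg (hm : 1 ≤ m) (n : ℕ) (hα₀ : 0 < α) (hα₁ : α ≤ 1) :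
    0 ≤ Real.log (((m : ℝ) + n) / α) := by
  refine Real.log_nonneg ((one_le_div hα₀).2 (hα₁.trans ?_))
  exact_mod_cast (by omega : 1 ≤ m + n)

theorem mul_log_add_le_oracleRemainder (hm : 1 ≤ m) (hn : n = 2 * m) (hρ : 0 ≤ ρ) (ϰ : ℝ) (s : ℕ)
    (hα₀ : 0 < α) (hα₁ : α ≤ 1) :
    ρ * Real.log (((m : ℝ) + n) / α) + ρ * ϰ * √(1 + Real.log (1 / α)) + s
      ≤ oracleRemainder m n ρ ϰ s α := by
  have hratio : 1 ≤ ((n : ℝ) + 1) / ((m : ℝ) + 1) := by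
    rw [one_le_div (by positivity), hn]
    push_cast
    linarith [(Nat.cast_nonneg m : (0 : ℝ) ≤ m)]
  have hlog := log_add_div_nonneg hm n hα₀ hα₁
  rw [oracleRemainder]
  gcongr
  exact le_mul_of_one_le_right hρ hratio

theorem window_bound_le_oracleRemainder (hm : 1 ≤ m) (hn : n = 2 * m) (hρ : 1 ≤ ρ) (hϰ : 0 ≤ ϰ)
    (hα₀ : 0 < α) (hα₁ : α ≤ 1) (hl : 1 + l ≤ 4 * (1 + Real.log (1 / α)))
    (hl' : 1 + l' ≤ 6 * Real.log (((m : ℝ) + n) / α)) :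
    80 * (ρ ^ 2 * (1 + l)) + 24 * (s + l) + 24 * (ρ * ϰ * √(1 + l)) + 96 * (ρ * (√s + 1 + l'))
      ≤ 600 * (ρ ^ 2 * (1 + Real.log (1 / α)) + oracleRemainder m n ρ ϰ s α) := by
  have hρ₀ : 0 ≤ ρ := by positivity
  have hL := Real.log_nonneg (one_le_one_div hα₀ hα₁)
  have hremainder := mul_log_add_le_oracleRemainder hm hn hρ₀ ϰ s hα₀ hα₁
  have hΛ := mul_nonneg hρ₀ (log_add_div_nonneg hm n hα₀ hα₁)
  have hsqrt : √(1 + l) ≤ 2 * √(1 + Real.log (1 / α)) := by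
    rw [Real.sqrt_le_left (by positivity), mul_pow, Real.sq_sqrt (by positivity)]
    linarith
  have hρL : 1 + Real.log (1 / α) ≤ ρ ^ 2 * (1 + Real.log (1 / α)) :=
    le_mul_of_one_le_left (by positivity) (one_le_pow₀ hρ)
  have hρs : 2 * ρ * √s ≤ ρ ^ 2 + s :=
    (two_mul_le_add_sq ρ √s).trans_eq (by rw [Real.sq_sqrt (Nat.cast_nonneg s)])
  have hρ_sq_nonneg := mul_nonneg (sq_nonneg ρ) hL
  have hϰ_nonneg : 0 ≤ ρ * ϰ * √(1 + Real.log (1 / α)) := by positivity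
  linarith [mul_le_mul_of_nonneg_left hl (sq_nonneg ρ), mul_le_mul_of_nonneg_left hl' hρ₀,
    mul_le_mul_of_nonneg_left hsqrt (mul_nonneg hρ₀ hϰ)]

theorem pointwise_bound_le_oracleRemainder (hm : 1 ≤ m) (hn : n = 2 * m) (hρ : 1 ≤ ρ)
    (hϰ : 0 ≤ ϰ) (hα₀ : 0 < α) (hα₁ : α ≤ 1) (hl : 1 + l ≤ 4 * (1 + Real.log (1 / α)))
    (hl' : 1 + l' ≤ 6 * Real.log (((m : ℝ) + n) / α)) :
    2 + 8 * ρ ^ 2 + 16 * (ρ * (1 + l')) + 32 * (ρ ^ 2 * (1 + l))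
      ≤ 200 * (ρ ^ 2 * (1 + Real.log (1 / α)) + oracleRemainder m n ρ ϰ s α) := by
  have hρ₀ : 0 ≤ ρ := by positivity
  have hL := Real.log_nonneg (one_le_one_div hα₀ hα₁)
  have hremainder := mul_log_add_le_oracleRemainder hm hn hρ₀ ϰ s hα₀ hα₁
  have hΛ := mul_nonneg hρ₀ (log_add_div_nonneg hm n hα₀ hα₁)
  have hρ_sq : 1 ≤ ρ ^ 2 := one_le_pow₀ hρ
  have hρ_sq_nonneg := mul_nonneg (sq_nonneg ρ) hL
  have hϰ_nonneg : 0 ≤ ρ * ϰ * √(1 + Real.log (1 / α)) := by positivity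
  linarith [mul_le_mul_of_nonneg_left hl (sq_nonneg ρ), mul_le_mul_of_nonneg_left hl' hρ₀]

namespace IsGoodNoise

variable {h : ℕ} {σ : ℝ} {q x xS ε z φ : ℤ → ℂ}

theorem norm_window_error_sq_le_oracleRemainder {S : Submodule ℂ (ℤ → ℂ)}
    (hz : IsGoodNoise m n h s ρ (ϰ * σ) l l' (S.map (window _)) q ε z)
    (hq : IsOracleFilter m (n + 2 * h) h ρ σ (xS + ε) q) (hS : ∀ u ∈ S, shiftSeq 1 u ∈ S)
    (hxS : xS ∈ S) (hm : 1 ≤ m) (hn : n = 2 * m) (hρ : 1 ≤ ρ) (hσ : 0 ≤ σ) (hϰ : 0 ≤ ϰ)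
    (hα₀ : 0 < α) (hα₁ : α ≤ 1) (hl₀ : 0 ≤ l) (hl₀' : 0 ≤ l')
    (hl : 1 + l ≤ 4 * (1 + Real.log (1 / α)))
    (hl' : 1 + l' ≤ 6 * Real.log (((m : ℝ) + n) / α))
    (hφ : IsPredictLSE n (2 * h) (2 * ρ) (observedSeq (xS + ε) σ z) φ) :
    ‖window (Finset.Icc ((2 * h : ℕ) : ℤ) (n + (2 * h : ℕ)))
        (xS + ε - convSeq φ (observedSeq (xS + ε) σ z))‖ ^ 2
      ≤ σ ^ 2 * (600 * (ρ ^ 2 * (1 + Real.log (1 / α)) + oracleRemainder m n ρ ϰ s α)) :=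
  (hz.norm_window_error_sq_le hq hS hxS hn hρ hσ hϰ hl₀ hl₀' hφ).trans
    (mul_le_mul_of_nonneg_left (window_bound_le_oracleRemainder hm hn hρ hϰ hα₀ hα₁ hl hl')
      (sq_nonneg σ))

theorem norm_error_apply_sq_le_oracleRemainder {K} (hz : IsGoodNoise m n h s ρ η l l' K q ε z)
    (hq : IsOracleFilter m (n + 2 * h) h ρ σ x q) (hm : 1 ≤ m) (hn : n = 2 * m) (hρ : 1 ≤ ρ)
    (hϰ : 0 ≤ ϰ) (hα₀ : 0 < α) (hα₁ : α ≤ 1) (hl : 1 + l ≤ 4 * (1 + Real.log (1 / α)))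
    (hl' : 1 + l' ≤ 6 * Real.log (((m : ℝ) + n) / α))
    (hφ : φ ∈ predictFeasible n (2 * h) (2 * ρ))
    (hwindow : ‖window (Finset.Icc ((2 * h : ℕ) : ℤ) (n + (2 * h : ℕ)))
        (x - convSeq φ (observedSeq x σ z))‖ ^ 2
      ≤ σ ^ 2 * (600 * (ρ ^ 2 * (1 + Real.log (1 / α)) + oracleRemainder m n ρ ϰ s α)))
    {t : ℤ} (ht : (m : ℤ) + 3 * h ≤ t) (ht' : t ≤ n + 3 * h) :
    ‖(x - convSeq φ (observedSeq x σ z)) t‖ ^ 2 ≤ 4000 * (σ ^ 2 * ρ / (n + 1)) *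
      (ρ ^ 2 * (1 + Real.log (1 / α)) + oracleRemainder m n ρ ϰ s α) := by
  refine (hz.norm_error_apply_sq_le hq hn (by positivity) hφ ht ht').trans
    ((mul_le_mul_of_nonneg_left (add_le_add hwindow (mul_le_mul_of_nonneg_left
      (pointwise_bound_le_oracleRemainder (s := s) hm hn hρ hϰ hα₀ hα₁ hl hl') (sq_nonneg σ)))
      (by positivity)).trans_eq ?_)
  ring

end IsGoodNoise

end Remainder

theorem four_mul_div_add_mul_div_sq_le {m n : ℕ} (hn : n = 2 * m) {α : ℝ} (hα : 0 ≤ α) :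
    4 * (α / 8) + ((n : ℝ) + 1) * ((m + 5) * (α / (16 * ((n : ℝ) + 1) ^ 2))) ≤ α := by
  have hratio : ((m : ℝ) + 5) / (16 * ((n : ℝ) + 1)) ≤ 1 / 2 := by
    rw [div_le_div_iff₀ (by positivity) two_pos, hn]
    push_cast
    linarith
  calc 4 * (α / 8) + ((n : ℝ) + 1) * ((m + 5) * (α / (16 * ((n : ℝ) + 1) ^ 2)))
      = α / 2 + α * ((m + 5) / (16 * (n + 1))) := by
        field_simp
        ring
    _ ≤ α / 2 + α * (1 / 2) := by gcongr
    _ = α := by ring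

theorem mainTheorem11 :
    ∃ C : ℝ, 0 < C ∧
      ∀ (Ω : Type*) [MeasurableSpace Ω] (μ : Measure Ω) [IsProbabilityMeasure μ]
        (ζ : ℤ → Ω → ℂ) (_hζ : IsStdComplexGaussianNoise μ ζ)
        (σ : ℝ) (_hσ : 0 < σ)
        (m n h₀ s : ℕ) (_hm : 1 ≤ m) (_hn : n = 2 * m)
        (ρ ϰ : ℝ) (_hρ : 1 ≤ ρ) (_hϰ : 0 ≤ ϰ)
        (x : ℤ → ℂ)
        (_hpred : IsPredictableSignal μ ζ σ m (n + 2 * h₀) h₀ ρ x)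
        (_hshift : IsNearShiftInvariantOn (-(n : ℤ)) ((n : ℤ) + 2 * h₀) n s ϰ σ x)
        (α : ℝ) (_hα₀ : 0 < α) (_hα₁ : α < 1),
        ∃ Ξ : Set (ℤ → ℂ), MeasurableSet Ξ ∧
          1 - α ≤ μ.real {ω | (fun t => ζ t ω) ∈ Ξ} ∧
          ∀ z ∈ Ξ, ∀ φ : ℤ → ℂ,
            IsPredictLSE n (2 * h₀) (2 * ρ) (observedSeq x σ z) φ →
              windowNorm n
                  (shiftSeq (-(2 * h₀ : ℤ)) (x - convSeq φ (observedSeq x σ z))) ^ 2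
                ≤ C * σ ^ 2 *
                    (ρ ^ 2 * (1 + Real.log (1 / α)) + oracleRemainder m n ρ ϰ s α) ∧
              ∀ t : ℤ, (m : ℤ) + 3 * h₀ ≤ t → t ≤ (n : ℤ) + 3 * h₀ →
                ‖(x - convSeq φ (observedSeq x σ z)) t‖ ^ 2
                  ≤ C * (σ ^ 2 * ρ / ((n : ℝ) + 1)) *
                      (ρ ^ 2 * (1 + Real.log (1 / α)) + oracleRemainder m n ρ ϰ s α) := by
  refine ⟨4000, by norm_num, ?_⟩
  intro Ω _ μ _ ζ hζ σ hσ m n h₀ s hm hn ρ ϰ hρ hϰ x hpred hshift α hα₀ hα₁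
  obtain ⟨q, hq⟩ := hpred.exists_isOracleFilter hζ hσ
  obtain ⟨hs, -, S, _, hdim, hS, xS, hxS, ε, rfl, hε⟩ := hshift
  have hprob := (hq.isNoiseEvent_isGoodNoise hζ hn
    (S.map (window (Finset.Icc ((2 * h₀ : ℕ) : ℤ) (n + (2 * h₀ : ℕ))))) hs
    ((Submodule.finrank_map_le _ S).trans_eq hdim)
    (fun τ _ _ => hε τ (by linarith) (by linarith)) (by positivity : 0 < α / 8)
    (by positivity : 0 < α / (16 * ((n : ℝ) + 1) ^ 2))).mono
    (four_mul_div_add_mul_div_sq_le hn hα₀.le)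
  have hl := one_add_log_div_eight_le hα₀ hα₁.le
  have hl' := one_add_log_div_sq_le hm hn hα₀ hα₁.le
  have hl₀ := log_one_div_div_nonneg (by norm_num : (1 : ℝ) ≤ 8) hα₀ hα₁.le
  have hl₀' := log_one_div_div_nonneg (by nlinarith [n.cast_nonneg (α := ℝ)] :
    1 ≤ 16 * ((n : ℝ) + 1) ^ 2) hα₀ hα₁.le
  refine ⟨_, hprob.1, hprob.2, fun z hz φ hφ => ?_⟩
  have hwindow := hz.norm_window_error_sq_le_oracleRemainder hq hS hxS hm hn hρ hσ.le hϰ hα₀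
    hα₁.le hl₀ hl₀' hl hl' hφ
  refine ⟨?_, fun t ht ht' => hz.norm_error_apply_sq_le_oracleRemainder hq hm hn hρ hϰ hα₀ hα₁.le
    hl hl' hφ.1 hwindow ht ht'⟩
  rw [← Nat.cast_ofNat, ← Nat.cast_mul, windowNorm_shiftSeq]
  refine hwindow.trans ?_
  have hnonneg := (sq_nonneg _).trans hwindow
  linarith
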